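/- All groups are finite, and classes of groups are closed under isomorphism. Write $\pi(G)$ for the set of prime divisors of $|G|$. The Sylow graph $\Gamma_s(G)$ of a group $G$ is the directed graph with vertex set $\pi(G)$ in which $(p,q)$ is an edge if and only if $q\in\pi(N_G(P)/PC_G(P))$ for a Sylow $p$-subgroup $P$ of $G$, $p\in\pi(G)$. For a class of groups $\mathfrak{X}$ let $\Gamma_s(\mathfrak{X})=\bigcup_{G\in\mathfrak{X}}\Gamma_s(G)$ (union of the vertex sets and of the edge sets). The class $\mathfrak{X}$ is recognized by $\Gamma_s$ if $G_1\in\mathfrak{X}$ and $\Gamma_s(G_1)=\Gamma_s(G_2)$ imply $G_2\in\mathfrak{X}$. A formation is a class of groups closed under epimorphic images that contains every group $G$ having normal subgroups $N_1,\dots,N_n$ ($n\ge 1$) with $\bigcap_{i=1}^n N_i=1$ and all $G/N_i$ in the class; it is hereditary if it is closed under subgroups. **Theorem 4.5.** Let $\mathfrak{F}$ be a non-empty hereditary formation. If $\mathfrak{F}$ is recognized by the Sylow graph $\Gamma_s$, then the following statements hold. (a) $\Gamma_s(\mathfrak{F})$ is undirected: $(p,q)$ is an edge of $\Gamma_s(\mathfrak{F})$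 if and only if $(q,p)$ is. (b) $\mathfrak{F}$ is a solubly saturated formation with the Shemetkov property. That is, $\mathfrak{F}$ is a formation; $G/\Phi(G_{\mathfrak{S}})\in\mathfrak{F}$ implies $G\in\mathfrak{F}$ for every group $G$, where $G_{\mathfrak{S}}$ is the soluble radical of $G$ (the largest soluble normal subgroup) and $\Phi$ denotes the Frattini subgroup; and every group $G\notin\mathfrak{F}$ all of whose proper subgroups belong to $\mathfrak{F}$ is either a Schmidt group (a non-nilpotent group all of whose proper subgroups are nilpotent) or a group of prime order. -/

import Mathlib

/-- A directed graph given by a set `verts` of vertices (natural numbers) and a set `edges` of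
ordered pairs of vertices. Equality of such graphs is equality of both sets. -/
@[ext]
structure DirectedGraph where
  verts : Set ℕ
  edges : Set (ℕ × ℕ)
  edges_mem : ∀ a b : ℕ, (a, b) ∈ edges → a ∈ verts ∧ b ∈ verts

/-- A directed graph is undirected if its set of edges is symmetric. -/
def DirectedGraph.IsUndirected (Γ : DirectedGraph) : Prop :=
  ∀ a b : ℕ, (a, b) ∈ Γ.edges ↔ (b, a) ∈ Γ.edges

/-- A graph function assigns a graph to every finite group. -/
abbrev GraphFunction := ∀ (G : Type) [Group G] [Finite G], DirectedGraph

/-- For a subgroup `P` of `G`, the order of `N_G(P) / P C_G(P)`. -/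
noncomputable def cardNormalizerQuotient {G : Type} [Group G] (P : Subgroup G) : ℕ :=
  Nat.card (Subgroup.normalizer (P : Set G) ⧸
    (P ⊔ Subgroup.centralizer (P : Set G)).subgroupOf (Subgroup.normalizer (P : Set G)))

/-- The Sylow graph `Γ_s(G)`: the vertices are the prime divisors of `|G|`, and `(p, q)` is an
edge if and only if the prime `q` divides `|N_G(P) / P C_G(P)|` for a Sylow `p`-subgroup `P`. -/
noncomputable def sylowGraph : GraphFunction := fun G _ _ =>
  { verts := {p | p.Prime ∧ p ∣ Nat.card G}
    edges := {e | (e.1.Prime ∧ e.1 ∣ Nat.card G) ∧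
      ∃ P : Sylow e.1 G, e.2.Prime ∧ e.2 ∣ cardNormalizerQuotient (P : Subgroup G)}
    edges_mem := by
      rintro a b ⟨ha, P, hb, hdvd⟩
      refine ⟨ha, hb, hdvd.trans ?_⟩
      exact (Subgroup.card_quotient_dvd_card _).trans (Subgroup.card_subgroup_dvd_card _) }

/-- A class of finite groups, closed under isomorphism. (Every finite group is isomorphic to one
whose underlying set lives in `Type`.) -/
structure FiniteGroupClass where
  Mem : ∀ (G : Type) [Group G] [Finite G], Prop
  mem_of_mulEquiv : ∀ (G H : Type) [Group G] [Finite G] [Group H] [Finite H],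
    Nonempty (G ≃* H) → Mem G → Mem H

/-- The soluble radical `G_𝔖`: the subgroup generated by all soluble normal subgroups. -/
def solubleRadical (G : Type) [Group G] : Subgroup G :=
  sSup {N : Subgroup G | N.Normal ∧ Group.IsSolvable N}

instance solubleRadical_normal (G : Type) [Group G] : (solubleRadical G).Normal :=
  Subgroup.sSup_normal _ fun _ h => h.1

/-- `Φ(G_𝔖)`, the Frattini subgroup of the soluble radical, as a subgroup of `G`. -/
def frattiniSolubleRadical (G : Type) [Group G] : Subgroup G :=
  (frattini (solubleRadical G)).map (solubleRadical G).subtype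

instance frattiniSolubleRadical_normal (G : Type) [Group G] :
    (frattiniSolubleRadical G).Normal :=
  inferInstanceAs ((frattini (solubleRadical G)).map (solubleRadical G).subtype).Normal

/-- A Schmidt group: a non-nilpotent group all of whose proper subgroups are nilpotent. -/
def IsSchmidtGroup (G : Type) [Group G] : Prop :=
  ¬ Group.IsNilpotent G ∧ ∀ H : Subgroup G, H ≠ ⊤ → Group.IsNilpotent H

namespace FiniteGroupClass

/-- The class contains at least one group. -/
def IsNonempty (F : FiniteGroupClass) : Prop :=
  ∃ (G : Type) (_ : Group G) (_ : Finite G), F.Mem G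

/-- A formation: a class closed under epimorphic images (`Q`) and such that a group `G` with
normal subgroups `N₁, …, Nₙ` (`n ≥ 1`) of trivial intersection whose quotients `G / Nᵢ` all lie in
the class lies in the class itself (`R₀`). -/
structure IsFormation (F : FiniteGroupClass) : Prop where
  quotient_closed : ∀ (G H : Type) [Group G] [Finite G] [Group H] [Finite H] (f : G →* H),
    Function.Surjective f → F.Mem G → F.Mem H
  subdirect_closed : ∀ (G : Type) [Group G] [Finite G] (n : ℕ), 1 ≤ n →
    ∀ (N : Fin n → Subgroup G) [∀ i, (N i).Normal],
      (∀ i, F.Mem (G ⧸ N i)) → ⨅ i, N i = ⊥ → F.Mem G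

/-- A hereditary class: closed under subgroups. -/
def IsHereditary (F : FiniteGroupClass) : Prop :=
  ∀ (G : Type) [Group G] [Finite G] (H : Subgroup G), F.Mem G → F.Mem H

/-- `F` is recognized by the graph function `Γ`. -/
def IsRecognizedBy (F : FiniteGroupClass) (Γ : GraphFunction) : Prop :=
  ∀ (G₁ G₂ : Type) [Group G₁] [Finite G₁] [Group G₂] [Finite G₂],
    F.Mem G₁ → Γ G₁ = Γ G₂ → F.Mem G₂

/-- The graph `Γ(F)` of a class: the union of the graphs `Γ(G)` over all `G` in `F`. -/
def graph (F : FiniteGroupClass) (Γ : GraphFunction) : DirectedGraph where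
  verts := {p | ∃ (G : Type) (_ : Group G) (_ : Finite G), F.Mem G ∧ p ∈ (Γ G).verts}
  edges := {e | ∃ (G : Type) (_ : Group G) (_ : Finite G), F.Mem G ∧ e ∈ (Γ G).edges}
  edges_mem := by
    rintro a b ⟨G, i, j, hG, h⟩
    exact ⟨⟨G, i, j, hG, ((Γ G).edges_mem a b h).1⟩, ⟨G, i, j, hG, ((Γ G).edges_mem a b h).2⟩⟩

/-- `G` is `s`-critical for `F`: it is not in `F`, but all its proper subgroups are. -/
def IsSCritical (F : FiniteGroupClass) (G : Type) [Group G] [Finite G] : Prop :=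
  ¬ F.Mem G ∧ ∀ H : Subgroup G, H ≠ ⊤ → F.Mem H

/-- The Shemetkov property: every `s`-critical group for `F` is a Schmidt group or a group of
prime order. -/
def HasShemetkovProperty (F : FiniteGroupClass) : Prop :=
  ∀ (G : Type) [Group G] [Finite G], F.IsSCritical G →
    IsSchmidtGroup G ∨ (Nat.card G).Prime

/-- Soluble saturation: `G / Φ(G_𝔖) ∈ F` implies `G ∈ F`. -/
def IsSolublySaturated (F : FiniteGroupClass) : Prop :=
  ∀ (G : Type) [Group G] [Finite G], F.Mem (G ⧸ frattiniSolubleRadical G) → F.Mem G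

end FiniteGroupClass

/-! A hereditary formation recognized by the Sylow graph consists exactly of the groups whose graph
lies in the graph of the formation (`mem_of_sylowGraph_subset`). An edge (p, q) means that a
q-element x normalizes a Sylow p-subgroup P without centralizing it; the subgroup P⟨x⟩ then has that
single edge. Since direct products unite graphs, every finite subgraph of the graph of F is realized
inside F, and recognition does the rest.

Undirectedness: let H be a Frobenius group with p-kernel and complement of order q. The wreath
product of a group of order q by H has no edges except possibly (p, q), but its subgroup "base times
kernel" has the edge (q, p). So if (p, q) is an edge of F, the wreath product lies in F, and by
heredity so does that subgroup.

Shemetkov property: the graph of a critical group G has a vertex or an edge outside that of F. A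
missing vertex r forces G to be cyclic of order r. A missing edge (p, q) forces G = P⟨x⟩ with P
normal, and proper subgroups, lacking this edge, are nilpotent.

Soluble saturation: with R the soluble radical, G and G/Φ(R) have the same primes by
Schur–Zassenhaus. For edges, x must centralize P as soon as it does so modulo Φ(R). This is checked
in the soluble group ⟨x⟩R, where the p-part M of Φ(R) is nongenerating: a Hall–Higman argument
(`commute_of_nongenerating`) shows that x centralizes M, and coprime action then gives that x
centralizes P. -/

/-! ### Edges of the Sylow graph in terms of elements -/

/-- A `q`-element of the normalizer of some Sylow `p`-subgroup of `G` acts nontrivially on it. -/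
def HasSylowAction (G : Type) [Group G] (p q : ℕ) : Prop :=
  ∃ P : Sylow p G, ∃ x ∈ Subgroup.normalizer ((P : Subgroup G) : Set G),
    (∃ k, x ^ q ^ k = 1) ∧ ∃ u ∈ P, x * u ≠ u * x

theorem eq_one_of_pow_prime_pow {G : Type*} [Group G] {p q : ℕ} (hp : p.Prime) (hq : q.Prime)
    (hpq : p ≠ q) {x : G} {k l : ℕ} (hk : x ^ p ^ k = 1) (hl : x ^ q ^ l = 1) : x = 1 := by
  rw [← orderOf_eq_one_iff]
  exact Nat.eq_one_of_dvd_coprimes (Nat.coprime_pow_primes k l hp hq hpq)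
    (orderOf_dvd_of_pow_eq_one hk) (orderOf_dvd_of_pow_eq_one hl)

theorem IsPGroup.exists_pow_mem {G : Type*} [Group G] {p : ℕ} {P : Subgroup G}
    (hP : IsPGroup p P) {u : G} (hu : u ∈ P) : ∃ k, u ^ p ^ k = 1 := by
  obtain ⟨k, hk⟩ := (isPGroup_iff_pow_pow_eq_one.1 hP) ⟨u, hu⟩
  exact ⟨k, by simpa [Subtype.ext_iff] using hk⟩

/-- A `q`-element acting on a `p`-group `P`, trivially modulo a subgroup that it centralizes,
centralizes `P`. -/
theorem IsPGroup.commute_of_commutator_mem {G : Type*} [Group G] {p q : ℕ} (hp : p.Prime)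
    (hq : q.Prime) (hpq : p ≠ q) {P : Subgroup G} (hP : IsPGroup p P) {x : G} {k : ℕ}
    (hx : x ^ q ^ k = 1) {u : G} (hcP : u⁻¹ * (x * u * x⁻¹) ∈ P)
    (hc : Commute x (u⁻¹ * (x * u * x⁻¹))) : Commute x u := by
  set m := u⁻¹ * (x * u * x⁻¹) with hm
  have key : ∀ n : ℕ, x ^ n * u * (x ^ n)⁻¹ = u * m ^ n := by
    intro n
    induction n with
    | zero => simp
    | succ n ih =>
      have h1 : x * u * x⁻¹ = u * m := by rw [hm]; group
      have h2 : x * m ^ n * x⁻¹ = m ^ n := by rw [(hc.pow_right n).eq]; group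
      calc x ^ (n + 1) * u * (x ^ (n + 1))⁻¹ = x * (x ^ n * u * (x ^ n)⁻¹) * x⁻¹ := by
            rw [pow_succ']; group
        _ = (x * u * x⁻¹) * (x * m ^ n * x⁻¹) := by rw [ih]; group
        _ = u * m ^ (n + 1) := by rw [h1, h2, pow_succ', mul_assoc]
  have hmq : m ^ q ^ k = 1 := by simpa [hx] using (key (q ^ k)).symm
  obtain ⟨l, hl⟩ := hP.exists_pow_mem hcP
  have hm1 : m = 1 := eq_one_of_pow_prime_pow hp hq hpq hl hmq
  have h3 : x * u * x⁻¹ = u := by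
    have := key 1
    rwa [hm1, pow_one, pow_one, mul_one] at this
  exact mul_inv_eq_iff_eq_mul.1 h3

/-- If q divides |N : PC|, a Sylow q-subgroup of N is not inside PC. Conversely, suppose a q-element
x = vc lies in PC, with v in P and c in C. Then v and c commute, so a q-power of v lies in C; v has
order prime to q, so v, and hence x, lies in C. -/
theorem mem_edges_sylowGraph_iff (G : Type) [Group G] [Finite G] (p q : ℕ) :
    (p, q) ∈ (sylowGraph G).edges ↔ p.Prime ∧ q.Prime ∧ p ≠ q ∧ HasSylowAction G p q := by
  constructor
  · rintro ⟨⟨hp, hpG⟩, P, hq, hdvd⟩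
    dsimp only at hp hpG P hq hdvd
    have := Fact.mk hp
    have := Fact.mk hq
    set N := Subgroup.normalizer ((P : Subgroup G) : Set G)
    set C := Subgroup.centralizer ((P : Subgroup G) : Set G)
    have hdvd' : q ∣ (((P : Subgroup G) ⊔ C).subgroupOf N).index := hdvd
    refine ⟨hp, hq, ?_, ?_⟩
    · rintro rfl
      refine P.not_dvd_index (hdvd'.trans ?_)
      exact (Subgroup.relIndex_dvd_of_le_left N le_sup_left).trans
        (Subgroup.relIndex_dvd_index_of_le Subgroup.le_normalizer)
    · obtain ⟨S⟩ : Nonempty (Sylow q N) := inferInstance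
      have hS : ¬ (S : Subgroup N) ≤ ((P : Subgroup G) ⊔ C).subgroupOf N := fun h =>
        S.not_dvd_index (hdvd'.trans (Subgroup.index_dvd_of_le h))
      obtain ⟨x, hxS, hx⟩ := SetLike.not_le_iff_exists.1 hS
      refine ⟨P, x, x.2, ?_, ?_⟩
      · obtain ⟨k, hk⟩ := S.2.exists_pow_mem hxS
        exact ⟨k, by simpa using congrArg Subtype.val hk⟩
      · by_contra! hc
        refine hx (Subgroup.mem_subgroupOf.2 (Subgroup.mem_sup_right ?_))
        exact Subgroup.mem_centralizer_iff.2 fun u hu => (hc u hu).symm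
  · rintro ⟨hp, hq, hpq, P, x, hxN, ⟨k, hk⟩, u, hu, hxu⟩
    have := Fact.mk hp
    have := Fact.mk hq
    have hpG : p ∣ Nat.card G := by
      by_contra h
      have hb : (P : Subgroup G) = ⊥ := by
        rw [← Subgroup.card_eq_one]
        obtain ⟨n, hn⟩ := IsPGroup.iff_card.1 P.2
        have hn' : Nat.card (P : Subgroup G) = p ^ n := hn
        rcases Nat.eq_zero_or_pos n with rfl | h0
        · simpa using hn'
        · exact absurd (((dvd_pow_self p h0.ne').trans hn'.symm.dvd).trans
            (Subgroup.card_subgroup_dvd_card _)) h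
      have : u = 1 := by
        have : u ∈ (P : Subgroup G) := hu
        rwa [hb, Subgroup.mem_bot] at this
      exact hxu (by simp [this])
    refine ⟨⟨hp, hpG⟩, P, hq, ?_⟩
    dsimp only at P hu hxN ⊢
    set N := Subgroup.normalizer ((P : Subgroup G) : Set G) with hN
    set C := Subgroup.centralizer ((P : Subgroup G) : Set G) with hC
    have hPN : (P : Subgroup G) ≤ N := Subgroup.le_normalizer
    have hCN : C ≤ N := Subgroup.centralizer_le_normalizer _
    have n1 : ((P : Subgroup G).subgroupOf N).Normal := Subgroup.normal_in_normalizer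
    have n2 : (C.subgroupOf N).Normal := Subgroup.normal_subgroupOf_centralizer_normalizer _
    have hsup : ((P : Subgroup G) ⊔ C).subgroupOf N =
        (P : Subgroup G).subgroupOf N ⊔ C.subgroupOf N := Subgroup.subgroupOf_sup hPN hCN
    have hx : (⟨x, hxN⟩ : N) ∉ ((P : Subgroup G) ⊔ C).subgroupOf N := by
      rw [hsup, Subgroup.mem_sup_of_normal_right]
      rintro ⟨⟨v, hvN⟩, hv, ⟨c, hcN⟩, hc, hvc⟩
      rw [Subgroup.mem_subgroupOf] at hv hc
      have hvc' : v * c = x := congrArg Subtype.val hvc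
      dsimp only at hv hc
      have hcomm : Commute v c := Subgroup.mem_centralizer_iff.1 hc v hv
      have hpow : v ^ q ^ k * c ^ q ^ k = 1 := by rw [← hcomm.mul_pow, hvc', hk]
      have hvk : v ^ q ^ k ∈ C := by
        rw [eq_inv_of_mul_eq_one_left hpow]
        exact C.inv_mem (C.pow_mem hc _)
      obtain ⟨l, hl⟩ := P.2.exists_pow_mem hv
      have hcop : (q ^ k).Coprime (orderOf v) :=
        Nat.Coprime.coprime_dvd_right (orderOf_dvd_of_pow_eq_one hl)
          (Nat.coprime_pow_primes k l hq hp hpq.symm)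
      obtain ⟨m, hm⟩ := exists_pow_eq_self_of_coprime hcop
      have hvC : v ∈ C := hm ▸ C.pow_mem hvk m
      have hxC : x ∈ C := hvc' ▸ C.mul_mem hvC hc
      exact hxu (Subgroup.mem_centralizer_iff.1 hxC u hu).symm
    have hnorm : (((P : Subgroup G) ⊔ C).subgroupOf N).Normal := by
      rw [hsup]; infer_instance
    have hne : (QuotientGroup.mk (⟨x, hxN⟩ : N) :
        N ⧸ ((P : Subgroup G) ⊔ C).subgroupOf N) ≠ 1 := by
      rwa [Ne, QuotientGroup.eq_one_iff]
    have hpow : (QuotientGroup.mk (⟨x, hxN⟩ : N) :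
        N ⧸ ((P : Subgroup G) ⊔ C).subgroupOf N) ^ q ^ k = 1 := by
      rw [← QuotientGroup.mk_pow]
      have : (⟨x, hxN⟩ : N) ^ q ^ k = 1 := Subtype.ext (by simpa using hk)
      rw [this, QuotientGroup.mk_one]
    obtain ⟨j, -, hj⟩ := (Nat.dvd_prime_pow hq).1 (orderOf_dvd_of_pow_eq_one hpow)
    have hj0 : j ≠ 0 := by
      rintro rfl
      exact hne (orderOf_eq_one_iff.1 (by simpa using hj))
    exact ((dvd_pow_self q hj0).trans hj.symm.dvd).trans (orderOf_dvd_natCard _)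

theorem HasSylowAction.of_surjective {G H : Type} [Group G] [Finite G] [Group H] [Finite H]
    (f : G →* H) (hf : Function.Surjective f) {p q : ℕ} (hp : p.Prime) (P : Sylow p G) {x u : G}
    (hx : x ∈ Subgroup.normalizer ((P : Subgroup G) : Set G)) (hq : ∃ k, x ^ q ^ k = 1)
    (hu : u ∈ P) (hxu : f x * f u ≠ f u * f x) : HasSylowAction H p q := by
  have := Fact.mk hp
  refine ⟨P.mapSurjective hf, f x, ?_, ?_, f u, ⟨u, hu, rfl⟩, hxu⟩
  · rw [Sylow.coe_mapSurjective]
    exact Subgroup.le_normalizer_map f ⟨x, hx, rfl⟩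
  · obtain ⟨k, hk⟩ := hq
    exact ⟨k, by rw [← map_pow, hk, map_one]⟩

/-- Every `p`-element lies in a normal Sylow `p`-subgroup. -/
theorem Sylow.mem_of_normal {G : Type*} [Group G] [Finite G] {p : ℕ} [Fact p.Prime] (P : Sylow p G)
    [hP : (P : Subgroup G).Normal] {x : G} {k : ℕ} (hx : x ^ p ^ k = 1) : x ∈ P := by
  have hz : IsPGroup p (Subgroup.zpowers x) := by
    refine IsPGroup.of_card_dvd_pow (n := k) ?_
    rw [Nat.card_zpowers]
    exact orderOf_dvd_of_pow_eq_one hx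
  obtain ⟨Q, hQ⟩ := hz.exists_le_sylow
  have := P.unique_of_normal hP
  rw [Subsingleton.elim P Q]
  exact hQ (Subgroup.mem_zpowers x)

/-- All p-elements lie in P, so the commutator of a p-element normalizing R with an element of R
lies in the trivial group P ∩ R. -/
theorem not_hasSylowAction_of_normal {G : Type} [Group G] [Finite G] {p r : ℕ} (hp : p.Prime)
    (hr : r.Prime) (hpr : p ≠ r) (P : Sylow p G) (hP : (P : Subgroup G).Normal) :
    ¬ HasSylowAction G r p := by
  rintro ⟨R, y, hyN, ⟨k, hk⟩, u, hu, hyu⟩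
  have := Fact.mk hp
  have hy : y ∈ (P : Subgroup G) := P.mem_of_normal hk
  have h1 : y * u * y⁻¹ * u⁻¹ ∈ (R : Subgroup G) :=
    mul_mem ((Subgroup.mem_normalizer_iff.1 hyN u).1 hu) (inv_mem hu)
  have h2 : y * u * y⁻¹ * u⁻¹ ∈ (P : Subgroup G) := by
    have := mul_mem hy (hP.conj_mem _ (inv_mem hy) u)
    simpa only [mul_assoc] using this
  obtain ⟨a, ha⟩ := P.2.exists_pow_mem h2
  obtain ⟨b, hb⟩ := R.2.exists_pow_mem h1
  have h3 := eq_one_of_pow_prime_pow hp hr hpr ha hb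
  exact hyu (mul_inv_eq_iff_eq_mul.1 (mul_inv_eq_one.1 h3))

/-- The subgroup is P⟨x⟩, small enough for its Sylow graph to be computed completely. -/
theorem HasSylowAction.exists_subgroup {G : Type} [Group G] {p q : ℕ}
    (h : HasSylowAction G p q) :
    ∃ (H : Subgroup G) (P : Sylow p H), (P : Subgroup H).Normal ∧ ∃ x : H, (∃ k, x ^ q ^ k = 1) ∧
      (P : Subgroup H) ⊔ Subgroup.zpowers x = ⊤ ∧ ∃ u ∈ P, x * u ≠ u * x := by
  obtain ⟨P, x, hx, ⟨k, hk⟩, u, hu, hxu⟩ := h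
  have hPH : (P : Subgroup G) ≤ (P : Subgroup G) ⊔ Subgroup.zpowers x := le_sup_left
  have hzH : Subgroup.zpowers x ≤ (P : Subgroup G) ⊔ Subgroup.zpowers x := le_sup_right
  have hxH : x ∈ (P : Subgroup G) ⊔ Subgroup.zpowers x := hzH (Subgroup.mem_zpowers x)
  refine ⟨(P : Subgroup G) ⊔ Subgroup.zpowers x, P.subtype hPH, ?_, ⟨x, hxH⟩, ⟨k, ?_⟩, ?_,
    ⟨u, hPH hu⟩, ?_, ?_⟩
  · rw [Sylow.coe_subtype, Subgroup.normal_subgroupOf_iff_le_normalizer hPH]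
    exact sup_le Subgroup.le_normalizer (by rwa [Subgroup.zpowers_le])
  · exact Subtype.ext (by simpa using hk)
  · have hz : Subgroup.zpowers (⟨x, hxH⟩ : ((P : Subgroup G) ⊔ Subgroup.zpowers x : Subgroup G)) =
        (Subgroup.zpowers x).subgroupOf ((P : Subgroup G) ⊔ Subgroup.zpowers x) := by
      refine Subgroup.map_injective (Subgroup.subtype_injective _) ?_
      rw [MonoidHom.map_zpowers, Subgroup.map_subgroupOf_eq_of_le hzH]
      rfl
    rw [Sylow.coe_subtype, hz, ← Subgroup.subgroupOf_sup hPH hzH, Subgroup.subgroupOf_self]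
  · exact hu
  · exact fun h => hxu (congrArg Subtype.val h)

theorem prime_eq_or_eq_of_sup_zpowers_eq_top {G : Type*} [Group G] [Finite G] {p q : ℕ}
    (hp : p.Prime) (hq : q.Prime) (P : Sylow p G) (hP : (P : Subgroup G).Normal) {x : G} {k : ℕ}
    (hx : x ^ q ^ k = 1) (htop : (P : Subgroup G) ⊔ Subgroup.zpowers x = ⊤) {r : ℕ}
    (hr : r.Prime) (hrG : r ∣ Nat.card G) : r = p ∨ r = q := by
  have := Fact.mk hr
  obtain ⟨h, hh⟩ := exists_prime_orderOf_dvd_card' r hrG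
  have hmem : h ∈ (P : Subgroup G) ⊔ Subgroup.zpowers x := htop ▸ Subgroup.mem_top h
  obtain ⟨u, hu, z, hz, rfl⟩ := Subgroup.mem_sup_of_normal_left.1 hmem
  have hzq : z ^ q ^ k = 1 := by
    obtain ⟨i, rfl⟩ := Subgroup.mem_zpowers_iff.1 hz
    rw [← zpow_natCast, ← zpow_mul, mul_comm, zpow_mul, zpow_natCast, hx, one_zpow]
  -- Modulo P every element is a power of x, so its order divides a power of q times a power of p.
  have hmemP : (u * z) ^ q ^ k ∈ (P : Subgroup G) := by
    rw [← QuotientGroup.eq_one_iff, QuotientGroup.mk_pow, QuotientGroup.mk_mul,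
      (QuotientGroup.eq_one_iff u).2 hu, one_mul, ← QuotientGroup.mk_pow, hzq, QuotientGroup.mk_one]
  obtain ⟨l, hl⟩ := P.2.exists_pow_mem hmemP
  rw [← pow_mul] at hl
  have hd : r ∣ q ^ k * p ^ l := hh ▸ orderOf_dvd_of_pow_eq_one hl
  rcases (hr.dvd_mul).1 hd with h | h
  · exact Or.inr ((Nat.prime_dvd_prime_iff_eq hr hq).1 (hr.dvd_of_dvd_pow h))
  · exact Or.inl ((Nat.prime_dvd_prime_iff_eq hr hp).1 (hr.dvd_of_dvd_pow h))

theorem dvd_card_of_pow_eq_one {G : Type*} [Group G] [Finite G] {q : ℕ} (hq : q.Prime) {x : G}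
    {k : ℕ} (hx : x ^ q ^ k = 1) (h1 : x ≠ 1) : q ∣ Nat.card G := by
  obtain ⟨j, -, hj⟩ := (Nat.dvd_prime_pow hq).1 (orderOf_dvd_of_pow_eq_one hx)
  have hj0 : j ≠ 0 := by
    rintro rfl
    exact h1 (orderOf_eq_one_iff.1 (by simpa using hj))
  exact ((dvd_pow_self q hj0).trans hj.symm.dvd).trans (orderOf_dvd_natCard _)

theorem sylowGraph_of_sup_zpowers_eq_top {G : Type} [Group G] [Finite G] {p q : ℕ} (hp : p.Prime)
    (hq : q.Prime) (hpq : p ≠ q) (P : Sylow p G) (hP : (P : Subgroup G).Normal) {x : G} {k : ℕ}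
    (hx : x ^ q ^ k = 1) (htop : (P : Subgroup G) ⊔ Subgroup.zpowers x = ⊤)
    (hu : ∃ u ∈ P, x * u ≠ u * x) :
    (sylowGraph G).verts = {p, q} ∧ (sylowGraph G).edges = {(p, q)} := by
  have he : (p, q) ∈ (sylowGraph G).edges := by
    refine (mem_edges_sylowGraph_iff G p q).2 ⟨hp, hq, hpq, P, x, ?_, ⟨k, hx⟩, hu⟩
    rw [Subgroup.normalizer_eq_top_iff.2 hP]
    trivial
  have hv := (sylowGraph G).edges_mem p q he
  have hsub : ∀ r ∈ (sylowGraph G).verts, r = p ∨ r = q := fun r hr =>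
    prime_eq_or_eq_of_sup_zpowers_eq_top hp hq P hP hx htop hr.1 hr.2
  refine ⟨Set.Subset.antisymm hsub ?_, Set.Subset.antisymm ?_ (by simpa using he)⟩
  · rintro r (rfl | rfl)
    exacts [hv.1, hv.2]
  · rintro ⟨r, s⟩ hrs
    obtain ⟨hr, hs, hne, hact⟩ := (mem_edges_sylowGraph_iff G r s).1 hrs
    have hmem := (sylowGraph G).edges_mem r s hrs
    have hsp : s ≠ p := by
      rintro rfl
      exact not_hasSylowAction_of_normal hs hr hne.symm P hP hact
    obtain rfl : s = q := (hsub s hmem.2).resolve_left hsp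
    obtain rfl : r = p := (hsub r hmem.1).resolve_right hne
    rfl

theorem hasSylowAction_prod_left {A B : Type} [Group A] [Finite A] [Group B] [Finite B] {p q : ℕ}
    (hp : p.Prime) (h : HasSylowAction A p q) : HasSylowAction (A × B) p q := by
  obtain ⟨P, x, hx, ⟨k, hk⟩, u, hu, hxu⟩ := h
  have := Fact.mk hp
  obtain ⟨Q⟩ : Nonempty (Sylow p B) := inferInstance
  have hpg : IsPGroup p ((P : Subgroup A).prod (Q : Subgroup B)) := by
    rw [isPGroup_iff_pow_pow_eq_one]
    rintro ⟨⟨a, b⟩, ha, hb⟩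
    obtain ⟨i, hi⟩ := P.2.exists_pow_mem ha
    obtain ⟨j, hj⟩ := Q.2.exists_pow_mem hb
    refine ⟨i + j, Subtype.ext (Prod.ext ?_ ?_)⟩
    · simp [pow_add, pow_mul, hi]
    · simp [pow_add, pow_mul', hj]
  have hidx : ¬ p ∣ ((P : Subgroup A).prod (Q : Subgroup B)).index := by
    rw [Subgroup.index_prod, hp.dvd_mul]
    exact not_or_intro P.not_dvd_index Q.not_dvd_index
  refine ⟨hpg.toSylow hidx, (x, 1), ?_, ⟨k, Prod.ext (by simpa using hk) (by simp)⟩, (u, 1), ?_, ?_⟩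
  · rw [IsPGroup.toSylow_coe, Subgroup.mem_normalizer_iff]
    rintro ⟨a, b⟩
    have := Subgroup.mem_normalizer_iff.1 hx a
    simp [Subgroup.mem_prod, this]
  · rw [IsPGroup.mem_toSylow]
    exact ⟨hu, Q.one_mem⟩
  · exact fun h => hxu (congrArg Prod.fst h)

theorem HasSylowAction.of_mulEquiv {G H : Type} [Group G] [Finite G] [Group H] [Finite H]
    (e : G ≃* H) {p q : ℕ} (hp : p.Prime) (h : HasSylowAction G p q) : HasSylowAction H p q := by
  obtain ⟨P, x, hx, hk, u, hu, hxu⟩ := h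
  refine HasSylowAction.of_surjective e.toMonoidHom e.surjective hp P hx hk hu fun h => hxu ?_
  exact e.injective (by simpa using h)

/-- A noncommuting pair in A × B already fails to commute in one coordinate, and both projections
preserve Sylow actions. -/
theorem hasSylowAction_prod_iff {A B : Type} [Group A] [Finite A] [Group B] [Finite B] {p q : ℕ}
    (hp : p.Prime) :
    HasSylowAction (A × B) p q ↔ HasSylowAction A p q ∨ HasSylowAction B p q := by
  constructor
  · rintro ⟨P, x, hx, hk, u, hu, hxu⟩
    by_cases h : x.1 * u.1 = u.1 * x.1
    · refine Or.inr (HasSylowAction.of_surjective (MonoidHom.snd A B) Prod.snd_surjective hp P hx hk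
        hu fun h' => hxu (Prod.ext h h'))
    · exact Or.inl (HasSylowAction.of_surjective (MonoidHom.fst A B) Prod.fst_surjective hp P hx hk
        hu h)
  · rintro (h | h)
    · exact hasSylowAction_prod_left hp h
    · exact HasSylowAction.of_mulEquiv MulEquiv.prodComm hp (hasSylowAction_prod_left (B := A) hp h)

theorem sylowGraph_prod (A B : Type) [Group A] [Finite A] [Group B] [Finite B] :
    (sylowGraph (A × B)).verts = (sylowGraph A).verts ∪ (sylowGraph B).verts ∧
      (sylowGraph (A × B)).edges = (sylowGraph A).edges ∪ (sylowGraph B).edges := by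
  constructor
  · ext p
    change p.Prime ∧ p ∣ Nat.card (A × B) ↔
      (p.Prime ∧ p ∣ Nat.card A) ∨ (p.Prime ∧ p ∣ Nat.card B)
    rw [Nat.card_prod, ← and_or_left]
    exact and_congr_right fun hp => hp.dvd_mul
  · ext ⟨p, q⟩
    rw [Set.mem_union]
    simp only [mem_edges_sylowGraph_iff]
    rw [← and_or_left]
    refine and_congr_right fun hp => ?_
    rw [hasSylowAction_prod_iff hp]
    tauto

/-- A group of prime power order has no edges in its Sylow graph. -/
theorem not_hasSylowAction_of_isPGroup {G : Type} [Group G] [Finite G] {p q r : ℕ}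
    (hp : p.Prime) (hr : r.Prime) (hpr : r ≠ q) (hq : q.Prime) (hG : IsPGroup p G) :
    ¬ HasSylowAction G r q := by
  rintro ⟨R, x, hx, ⟨k, hk⟩, u, hu, hxu⟩
  obtain ⟨i, hi⟩ := (isPGroup_iff_pow_pow_eq_one.1 hG) x
  obtain ⟨j, hj⟩ := (isPGroup_iff_pow_pow_eq_one.1 hG) u
  obtain ⟨l, hl⟩ := R.2.exists_pow_mem hu
  by_cases h : p = q
  · have : u = 1 := eq_one_of_pow_prime_pow hp hr (by rintro rfl; exact hpr h) hj hl
    exact hxu (by simp [this])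
  · have : x = 1 := eq_one_of_pow_prime_pow hp hq h hi hk
    exact hxu (by simp [this])

/-! ### Realizing finite subgraphs inside the formation -/

namespace FiniteGroupClass

theorem IsFormation.mem_prod {F : FiniteGroupClass} (hform : F.IsFormation) {A B : Type} [Group A]
    [Finite A] [Group B] [Finite B] (hA : F.Mem A) (hB : F.Mem B) : F.Mem (A × B) := by
  have hn : ∀ i, ((![(MonoidHom.fst A B).ker, (MonoidHom.snd A B).ker] : Fin 2 → _) i).Normal := by
    intro i
    fin_cases i <;> simp <;> infer_instance
  refine hform.subdirect_closed (A × B) 2 (by norm_num)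
    ![(MonoidHom.fst A B).ker, (MonoidHom.snd A B).ker] ?_ ?_
  · intro i
    fin_cases i
    · exact F.mem_of_mulEquiv _ _ ⟨(QuotientGroup.quotientKerEquivOfSurjective (MonoidHom.fst A B)
        Prod.fst_surjective).symm⟩ hA
    · exact F.mem_of_mulEquiv _ _ ⟨(QuotientGroup.quotientKerEquivOfSurjective (MonoidHom.snd A B)
        Prod.snd_surjective).symm⟩ hB
  · rw [eq_bot_iff]
    intro x hx
    rw [Subgroup.mem_iInf] at hx
    have h0 : x.1 = 1 := hx 0
    have h1 : x.2 = 1 := hx 1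
    exact Prod.ext h0 h1

variable {F : FiniteGroupClass}

theorem exists_mem_of_mem_verts (hher : F.IsHereditary) {p : ℕ}
    (h : p ∈ (F.graph sylowGraph).verts) :
    ∃ (H : Type) (_ : Group H) (_ : Finite H), F.Mem H ∧ (sylowGraph H).verts = {p} ∧
      (sylowGraph H).edges = ∅ := by
  obtain ⟨G, _, _, hG, hp, hpG⟩ := h
  have := Fact.mk hp
  obtain ⟨g, hg⟩ := exists_prime_orderOf_dvd_card' p hpG
  have hcard : Nat.card (Subgroup.zpowers g) = p := by rw [Nat.card_zpowers, hg]
  refine ⟨Subgroup.zpowers g, inferInstance, inferInstance, hher G _ hG, ?_, ?_⟩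
  · ext r
    change r.Prime ∧ r ∣ Nat.card (Subgroup.zpowers g) ↔ r = p
    rw [hcard]
    exact ⟨fun h => (Nat.prime_dvd_prime_iff_eq h.1 hp).1 h.2, by rintro rfl; exact ⟨hp, dvd_rfl⟩⟩
  · rw [Set.eq_empty_iff_forall_notMem]
    rintro ⟨r, q⟩ hrq
    obtain ⟨hr, hq, hne, hact⟩ := (mem_edges_sylowGraph_iff _ r q).1 hrq
    exact not_hasSylowAction_of_isPGroup hp hr hne hq
      (IsPGroup.of_card (n := 1) (by simpa using hcard)) hact

theorem exists_mem_of_mem_edges (hher : F.IsHereditary) {p q : ℕ}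
    (h : (p, q) ∈ (F.graph sylowGraph).edges) :
    ∃ (H : Type) (_ : Group H) (_ : Finite H), F.Mem H ∧ (sylowGraph H).verts = {p, q} ∧
      (sylowGraph H).edges = {(p, q)} := by
  obtain ⟨G, _, _, hG, he⟩ := h
  obtain ⟨hp, hq, hpq, hact⟩ := (mem_edges_sylowGraph_iff _ p q).1 he
  obtain ⟨H, P, hP, x, ⟨k, hk⟩, htop, hu⟩ := hact.exists_subgroup
  exact ⟨H, inferInstance, inferInstance, hher G H hG,
    sylowGraph_of_sup_zpowers_eq_top hp hq hpq P hP hk htop hu⟩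

theorem exists_mem_sylowGraph_finset_verts (hne : F.IsNonempty) (hform : F.IsFormation)
    (hher : F.IsHereditary) (V : Finset ℕ) (hV : ∀ p ∈ V, p ∈ (F.graph sylowGraph).verts) :
    ∃ (H : Type) (_ : Group H) (_ : Finite H), F.Mem H ∧ (sylowGraph H).verts = V ∧
      (sylowGraph H).edges = ∅ := by
  induction V using Finset.induction_on with
  | empty =>
    -- The trivial subgroup of any member realizes the empty graph.
    obtain ⟨G, _, _, hG⟩ := hne
    have hv : (sylowGraph (⊥ : Subgroup G)).verts = ∅ := by
      rw [Set.eq_empty_iff_forall_notMem]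
      rintro p ⟨hp, hd⟩
      rw [Subgroup.card_bot] at hd
      exact hp.one_lt.ne' (Nat.dvd_one.1 hd)
    refine ⟨(⊥ : Subgroup G), inferInstance, inferInstance, hher G _ hG, by simpa using hv, ?_⟩
    rw [Set.eq_empty_iff_forall_notMem]
    rintro ⟨r, q⟩ hrq
    have := ((sylowGraph (⊥ : Subgroup G)).edges_mem r q hrq).1
    simp [hv] at this
  | insert p V _ ih =>
    obtain ⟨A, _, _, hA, hvA, heA⟩ := ih fun r hr => hV r (Finset.mem_insert_of_mem hr)
    obtain ⟨B, _, _, hB, hvB, heB⟩ := exists_mem_of_mem_verts hher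
      (hV p (Finset.mem_insert_self p V))
    refine ⟨B × A, inferInstance, inferInstance, hform.mem_prod hB hA, ?_, ?_⟩
    · rw [(sylowGraph_prod B A).1, hvA, hvB, Finset.coe_insert, Set.singleton_union]
    · rw [(sylowGraph_prod B A).2, heA, heB, Set.union_empty]

theorem exists_mem_sylowGraph_finset (hne : F.IsNonempty) (hform : F.IsFormation)
    (hher : F.IsHereditary) (V : Finset ℕ) (hV : ∀ p ∈ V, p ∈ (F.graph sylowGraph).verts)
    (E : Finset (ℕ × ℕ)) (hE : ∀ e ∈ E, e ∈ (F.graph sylowGraph).edges)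
    (hEV : ∀ e ∈ E, e.1 ∈ V ∧ e.2 ∈ V) :
    ∃ (H : Type) (_ : Group H) (_ : Finite H), F.Mem H ∧ (sylowGraph H).verts = V ∧
      (sylowGraph H).edges = E := by
  induction E using Finset.induction_on with
  | empty => simpa using exists_mem_sylowGraph_finset_verts hne hform hher V hV
  | insert e E _ ih =>
    obtain ⟨A, _, _, hA, hvA, heA⟩ := ih (fun r hr => hE r (Finset.mem_insert_of_mem hr))
      (fun r hr => hEV r (Finset.mem_insert_of_mem hr))
    obtain ⟨B, _, _, hB, hvB, heB⟩ := exists_mem_of_mem_edges (p := e.1) (q := e.2) hher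
      (hE e (Finset.mem_insert_self e E))
    refine ⟨B × A, inferInstance, inferInstance, hform.mem_prod hB hA, ?_, ?_⟩
    · rw [(sylowGraph_prod B A).1, hvA, hvB, Set.union_eq_right]
      have := hEV e (Finset.mem_insert_self e E)
      rintro r (rfl | rfl)
      exacts [this.1, this.2]
    · rw [(sylowGraph_prod B A).2, heA, heB, Finset.coe_insert, Set.singleton_union]

/-- A nonempty hereditary formation recognized by the Sylow graph contains every group whose Sylow
graph is contained in the graph of the formation. -/
theorem mem_of_sylowGraph_subset (hne : F.IsNonempty) (hform : F.IsFormation)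
    (hher : F.IsHereditary) (hrec : F.IsRecognizedBy sylowGraph) (G : Type) [Group G] [Finite G]
    (hv : (sylowGraph G).verts ⊆ (F.graph sylowGraph).verts)
    (he : (sylowGraph G).edges ⊆ (F.graph sylowGraph).edges) : F.Mem G := by
  have hvf : (sylowGraph G).verts.Finite := by
    refine (Set.finite_le_nat (Nat.card G)).subset ?_
    rintro p ⟨-, hp⟩
    exact Nat.le_of_dvd Nat.card_pos hp
  have hef : (sylowGraph G).edges.Finite := by
    refine (hvf.prod hvf).subset ?_
    rintro ⟨p, q⟩ h
    exact (sylowGraph G).edges_mem p q h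
  -- The graph of G is finite, so some member H of F has exactly the same graph.
  obtain ⟨H, _, _, hH, hvH, heH⟩ := exists_mem_sylowGraph_finset hne hform hher hvf.toFinset
    (fun p hp => hv (by simpa using hp)) hef.toFinset (fun e h => he (by simpa using h))
    (fun e h => by simpa using (sylowGraph G).edges_mem e.1 e.2 (by simpa using h))
  refine hrec H G hH (DirectedGraph.ext ?_ ?_)
  · simpa using hvH
  · simpa using heH

theorem edges_subset_graph {G : Type} [Group G] [Finite G] (hG : F.Mem G) :
    (sylowGraph G).edges ⊆ (F.graph sylowGraph).edges :=
  fun _ h => ⟨G, inferInstance, inferInstance, hG, h⟩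

theorem verts_subset_graph {G : Type} [Group G] [Finite G] (hG : F.Mem G) :
    (sylowGraph G).verts ⊆ (F.graph sylowGraph).verts :=
  fun _ h => ⟨G, inferInstance, inferInstance, hG, h⟩

end FiniteGroupClass

/-! ### Reversing an edge with a wreath product -/

/-- A Frobenius group with kernel a `p`-group and complement of prime order `q`. -/
theorem exists_frobenius_group {p q : ℕ} (hp : p.Prime) (hq : q.Prime) (hpq : p ≠ q) :
    ∃ (H : Type) (_ : Group H) (_ : Finite H) (P : Sylow p H) (x : H),
      (P : Subgroup H).Normal ∧ x ^ q = 1 ∧ x ≠ 1 ∧ (P : Subgroup H) ⊔ Subgroup.zpowers x = ⊤ ∧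
      (∀ y ∈ P, ∀ z ∉ P, Commute z y → y = 1) ∧ ∃ a ∈ P, a ≠ 1 := by
  have := Fact.mk hp
  have := Fact.mk hq
  -- By Fermat, q divides p ^ (q - 1) - 1, so K has a unit of order q; it acts on the additive group
  -- of K by multiplication, fixing no nonzero vector.
  let K := GaloisField p (q - 1)
  have hq1 : q - 1 ≠ 0 := (Nat.sub_pos_of_lt hq.one_lt).ne'
  have : Finite K := Nat.finite_of_card_ne_zero (by
    rw [GaloisField.card p _ hq1]; exact pow_ne_zero _ hp.ne_zero)
  have hdvd : q ∣ Nat.card Kˣ := by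
    rw [Nat.card_units, GaloisField.card p _ hq1]
    have h := Nat.ModEq.pow_totient ((Nat.coprime_primes hp hq).2 hpq)
    rw [Nat.totient_prime hq] at h
    exact (Nat.modEq_iff_dvd' (Nat.one_le_pow _ _ hp.pos)).1 h.symm
  obtain ⟨ζ, hζ⟩ := exists_prime_orderOf_dvd_card' q hdvd
  let φ : Subgroup.zpowers ζ →* MulAut (Multiplicative K) :=
    (MulAutMultiplicative K).symm.toMonoidHom.comp
      ((DistribMulAction.toAddAut Kˣ K).comp (Subgroup.zpowers ζ).subtype)
  have hφ : ∀ (u : Subgroup.zpowers ζ) (a : Multiplicative K),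
      φ u a = Multiplicative.ofAdd ((u : Kˣ) • a.toAdd) := fun _ _ => rfl
  let H := Multiplicative K ⋊[φ] Subgroup.zpowers ζ
  have : Finite H := Finite.of_equiv _ SemidirectProduct.equivProd.symm
  let A : Subgroup H := (SemidirectProduct.rightHom (φ := φ)).ker
  have hA : ∀ g : H, g ∈ A ↔ g.right = 1 := fun g => MonoidHom.mem_ker
  have hApg : IsPGroup p A := by
    rw [isPGroup_iff_pow_pow_eq_one]
    rintro ⟨g, hg⟩
    refine ⟨1, Subtype.ext ?_⟩
    have hg' : g = SemidirectProduct.inl g.left := by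
      ext1
      · simp
      · simpa using (hA g).1 hg
    change g ^ p ^ 1 = 1
    rw [hg', ← map_pow, pow_one]
    have : g.left ^ p = 1 := by
      apply Multiplicative.toAdd.injective
      rw [toAdd_pow, toAdd_one, nsmul_eq_mul, CharP.cast_eq_zero, zero_mul]
    rw [this, map_one]
  have hAidx : ¬ p ∣ A.index := by
    rw [Subgroup.index_ker, MonoidHom.range_eq_top.2 SemidirectProduct.rightHom_surjective,
      Subgroup.card_top, Nat.card_zpowers, hζ, Nat.prime_dvd_prime_iff_eq hp hq]
    exact hpq
  let g : Subgroup.zpowers ζ := ⟨ζ, Subgroup.mem_zpowers ζ⟩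
  have hgq : g ^ q = 1 := Subtype.ext (by
    change ζ ^ q = 1
    exact orderOf_dvd_iff_pow_eq_one.1 hζ.dvd)
  have hg1 : g ≠ 1 := by
    intro h
    have : ζ = 1 := congrArg Subtype.val h
    rw [this, orderOf_one] at hζ
    exact hq.one_lt.ne hζ
  refine ⟨H, inferInstance, inferInstance, hApg.toSylow hAidx, SemidirectProduct.inr g, ?_, ?_, ?_,
    ?_, ?_, SemidirectProduct.inl (Multiplicative.ofAdd 1), ?_, ?_⟩
  · rw [IsPGroup.toSylow_coe]
    exact MonoidHom.normal_ker _
  · rw [← map_pow, hgq, map_one]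
  · exact fun h => hg1 (SemidirectProduct.inr_injective (h.trans (map_one _).symm))
  · rw [IsPGroup.toSylow_coe, eq_top_iff]
    rintro h -
    rw [← SemidirectProduct.inl_left_mul_inr_right h]
    refine mul_mem (Subgroup.mem_sup_left ((hA _).2 (by simp))) (Subgroup.mem_sup_right ?_)
    obtain ⟨i, hi⟩ := Subgroup.mem_zpowers_iff.1 h.right.2
    refine Subgroup.mem_zpowers_iff.2 ⟨i, ?_⟩
    rw [← map_zpow]
    exact congrArg _ (Subtype.ext (by simpa using hi))
  · intro y hy z hz hzy
    rw [IsPGroup.mem_toSylow, hA] at hy hz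
    have h1 : z.left * φ z.right y.left = y.left * φ y.right z.left :=
      congrArg SemidirectProduct.left hzy.eq
    rw [hy, map_one, MulAut.one_apply, mul_comm, mul_left_inj, hφ] at h1
    have h2 : ((z.right : Kˣ) : K) * y.left.toAdd = y.left.toAdd := congrArg Multiplicative.toAdd h1
    have h3 : y.left.toAdd = 0 := by
      by_contra h0
      exact hz (Subtype.ext (Units.ext (mul_eq_right₀ h0 |>.1 h2)))
    exact SemidirectProduct.ext (Multiplicative.toAdd.injective h3) hy
  · rw [IsPGroup.mem_toSylow, hA]
    simp
  · intro h
    have h' := SemidirectProduct.inl_injective (h.trans (map_one _).symm)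
    exact one_ne_zero (α := K) (congrArg Multiplicative.toAdd h')

namespace RegularWreathProduct

theorem pow_eq_one_of_mem_ker {H : Type*} [Group H] {q : ℕ}
    {y : Multiplicative (ZMod q) ≀ᵣ H} (hy : y.right = 1) : y ^ q = 1 := by
  have key : ∀ n : ℕ, (y ^ n).left = y.left ^ n ∧ (y ^ n).right = 1 := by
    intro n
    induction n with
    | zero => simp
    | succ n ih => simp [pow_succ, ih.1, ih.2, hy]
  refine RegularWreathProduct.ext ?_ (key q).2
  rw [(key q).1]
  funext h
  apply Multiplicative.toAdd.injective
  simp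

end RegularWreathProduct

/-- W is the regular wreath product of a group of order q by the Frobenius group H, and T is the
preimage of the Frobenius kernel P. The base group is a normal Sylow q-subgroup of T on which P acts
faithfully, whereas in W the complement obstructs the edge (q, p). -/
theorem exists_edge_swap_group {p q : ℕ} (hp : p.Prime) (hq : q.Prime) (hpq : p ≠ q) :
    ∃ (W : Type) (_ : Group W) (_ : Finite W), (sylowGraph W).verts ⊆ {p, q} ∧
      (sylowGraph W).edges ⊆ {(p, q)} ∧
      ∃ T : Subgroup W, (q, p) ∈ (sylowGraph T).edges := by
  obtain ⟨H, _, _, P, x, hP, hxq, hx1, htop, hfrob, a, haP, ha1⟩ := exists_frobenius_group hp hq hpq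
  have := Fact.mk hp
  have := Fact.mk hq
  let W := Multiplicative (ZMod q) ≀ᵣ H
  let f : W →* H := RegularWreathProduct.rightHom
  have hf : Function.Surjective f := fun h => ⟨RegularWreathProduct.inl h, rfl⟩
  have hker : ∀ y : W, y ∈ f.ker ↔ y.right = 1 := fun y => MonoidHom.mem_ker
  have hverts : ∀ r, r.Prime → r ∣ Nat.card W → r = p ∨ r = q := by
    intro r hr hrW
    rw [RegularWreathProduct.card, hr.dvd_mul] at hrW
    rcases hrW with h | h
    · have h' := hr.dvd_of_dvd_pow h
      rw [Nat.card_congr Multiplicative.toAdd, Nat.card_zmod] at h'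
      exact Or.inr ((Nat.prime_dvd_prime_iff_eq hr hq).1 h')
    · exact prime_eq_or_eq_of_sup_zpowers_eq_top hp hq P hP (k := 1) (by simpa using hxq) htop hr h
  have hqH : q ∣ Nat.card H := dvd_card_of_pow_eq_one hq (k := 1) (by simpa using hxq) hx1
  -- A p-element y normalizing a Sylow q-subgroup maps into P and normalizes a nontrivial q-subgroup
  -- of H. The commutators are both p- and q-elements, so the image of y commutes with some z
  -- outside P and is trivial. Then y lies in the base, a q-group, so y = 1.
  have hno : ¬ HasSylowAction W q p := by
    rintro ⟨S, y, hyN, ⟨k, hk⟩, u, -, hyu⟩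
    have hbk : f y ^ p ^ k = 1 := by rw [← map_pow, hk, map_one]
    have hb : f y ∈ (P : Subgroup H) := P.mem_of_normal hbk
    have hQ : ((S.mapSurjective hf : Sylow q H) : Subgroup H) ≠ ⊥ :=
      Sylow.ne_bot_of_dvd_card _ hqH
    obtain ⟨⟨z, hzQ⟩, hz⟩ := Subgroup.ne_bot_iff_exists_ne_one.1 hQ
    have hz1 : z ≠ 1 := fun h => hz (Subtype.ext h)
    obtain ⟨j, hj⟩ := (S.mapSurjective hf).2.exists_pow_mem hzQ
    have hzP : z ∉ P := fun h => by
      obtain ⟨i, hi⟩ := P.2.exists_pow_mem h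
      exact hz1 (eq_one_of_pow_prime_pow hp hq hpq hi hj)
    have hbN : f y ∈ Subgroup.normalizer (((S.mapSurjective hf : Sylow q H) : Subgroup H) : Set H) :=
      by
        rw [Sylow.coe_mapSurjective]
        exact Subgroup.le_normalizer_map f ⟨y, hyN, rfl⟩
    have hc1 : f y * z * (f y)⁻¹ * z⁻¹ ∈ ((S.mapSurjective hf : Sylow q H) : Subgroup H) :=
      mul_mem ((Subgroup.mem_normalizer_iff.1 hbN z).1 hzQ) (inv_mem hzQ)
    have hc2 : f y * z * (f y)⁻¹ * z⁻¹ ∈ (P : Subgroup H) := by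
      have := mul_mem hb (hP.conj_mem _ (inv_mem hb) z)
      simpa only [mul_assoc] using this
    obtain ⟨i, hi⟩ := P.2.exists_pow_mem hc2
    obtain ⟨l, hl⟩ := (S.mapSurjective hf).2.exists_pow_mem hc1
    have hcomm : Commute (f y) z :=
      mul_inv_eq_iff_eq_mul.1 (mul_inv_eq_one.1 (eq_one_of_pow_prime_pow hp hq hpq hi hl))
    have hy1 : f y = 1 := hfrob _ hb _ hzP hcomm.symm
    have : y = 1 := eq_one_of_pow_prime_pow (l := 1) hp hq hpq hk (by
      rw [pow_one]
      exact RegularWreathProduct.pow_eq_one_of_mem_ker hy1)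
    exact hyu (by rw [this, one_mul, mul_one])
  refine ⟨W, inferInstance, inferInstance, fun r hr => hverts r hr.1 hr.2, ?_,
    (P : Subgroup H).comap f, ?_⟩
  · rintro ⟨r, s⟩ hrs
    obtain ⟨hr, hs, hne, hact⟩ := (mem_edges_sylowGraph_iff W r s).1 hrs
    have hmem := (sylowGraph W).edges_mem r s hrs
    rcases hverts r hmem.1.1 hmem.1.2 with rfl | rfl <;>
      rcases hverts s hmem.2.1 hmem.2.2 with rfl | rfl
    · exact absurd rfl hne
    · rfl
    · exact absurd hact hno
    · exact absurd rfl hne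
  · set T := (P : Subgroup H).comap f
    have hVT : f.ker ≤ T := f.ker_le_comap _
    have hVpg : IsPGroup q (f.ker.subgroupOf T) := by
      rw [isPGroup_iff_pow_pow_eq_one]
      rintro ⟨⟨v, hvT⟩, hv⟩
      refine ⟨1, Subtype.ext (Subtype.ext ?_)⟩
      change v ^ q ^ 1 = 1
      rw [pow_one]
      exact RegularWreathProduct.pow_eq_one_of_mem_ker ((hker v).1 hv)
    have hVidx : ¬ q ∣ (f.ker.subgroupOf T).index := by
      change ¬ q ∣ f.ker.relIndex T
      rw [Subgroup.relIndex_ker, Subgroup.map_comap_eq_self_of_surjective hf]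
      intro h
      obtain ⟨n, hn⟩ := IsPGroup.iff_card.1 P.2
      rw [show Nat.card (P : Subgroup H) = p ^ n from hn] at h
      exact hpq ((Nat.prime_dvd_prime_iff_eq hq hp).1 (hq.dvd_of_dvd_pow h)).symm
    refine (mem_edges_sylowGraph_iff T q p).2 ⟨hq, hp, hpq.symm, hVpg.toSylow hVidx,
      ⟨RegularWreathProduct.inl a, haP⟩, ?_, ?_, ?_⟩
    · rw [IsPGroup.toSylow_coe, Subgroup.normalizer_eq_top_iff.2 inferInstance]
      trivial
    · obtain ⟨k, hk⟩ := P.2.exists_pow_mem haP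
      refine ⟨k, Subtype.ext ?_⟩
      change (RegularWreathProduct.inl a : W) ^ p ^ k = 1
      rw [← map_pow, hk, map_one]
    · classical
      let v : W := ⟨Pi.mulSingle 1 (Multiplicative.ofAdd 1), 1⟩
      have hv : v ∈ f.ker := (hker v).2 rfl
      refine ⟨⟨v, hVT hv⟩, ?_, ?_⟩
      · rw [IsPGroup.mem_toSylow]
        exact hv
      · intro h
        have h1 : (RegularWreathProduct.inl a : W) * v = v * RegularWreathProduct.inl a :=
          congrArg Subtype.val h
        have h2 := congrFun (congrArg RegularWreathProduct.left h1) 1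
        have ha' : a⁻¹ ≠ 1 := inv_ne_one.2 ha1
        -- Both products are evaluated at 1: conjugation by a moves the support of v away from 1.
        change 1 * v.left (a⁻¹ * 1) = v.left 1 * 1 at h2
        rw [one_mul, mul_one, mul_one] at h2
        have h3 : (1 : Multiplicative (ZMod q)) = Multiplicative.ofAdd 1 := by
          simpa [v, Pi.mulSingle_eq_of_ne ha'] using h2
        exact zero_ne_one (α := ZMod q) (congrArg Multiplicative.toAdd h3)

theorem FiniteGroupClass.graph_sylowGraph_isUndirected {F : FiniteGroupClass} (hne : F.IsNonempty)
    (hform : F.IsFormation) (hher : F.IsHereditary) (hrec : F.IsRecognizedBy sylowGraph) :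
    (F.graph sylowGraph).IsUndirected := by
  have key : ∀ p q, (p, q) ∈ (F.graph sylowGraph).edges → (q, p) ∈ (F.graph sylowGraph).edges := by
    intro p q h
    have hmem := (F.graph sylowGraph).edges_mem p q h
    obtain ⟨G, _, _, hG, he⟩ := h
    obtain ⟨hp, hq, hpq, -⟩ := (mem_edges_sylowGraph_iff G p q).1 he
    obtain ⟨W, _, _, hv, hE, T, hT⟩ := exists_edge_swap_group hp hq hpq
    have hW : F.Mem W := by
      refine mem_of_sylowGraph_subset hne hform hher hrec W (hv.trans ?_) (hE.trans ?_)
      · rintro r (rfl | rfl)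
        exacts [hmem.1, hmem.2]
      · rintro _ rfl
        exact edges_subset_graph hG he
    exact edges_subset_graph (hher W T hW) hT
  exact fun p q => ⟨key p q, key q p⟩

/-! ### The Shemetkov property -/

/-- The subgroup is explicit here, so that in a critical group it can be shown to be everything. -/
theorem hasSylowAction_sup_zpowers {G : Type} [Group G] {p q : ℕ} (P : Sylow p G) {x u : G}
    (hx : x ∈ Subgroup.normalizer ((P : Subgroup G) : Set G)) (hq : ∃ k, x ^ q ^ k = 1)
    (hu : u ∈ P) (hxu : x * u ≠ u * x) :
    HasSylowAction ((P : Subgroup G) ⊔ Subgroup.zpowers x : Subgroup G) p q := by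
  have hPH : (P : Subgroup G) ≤ (P : Subgroup G) ⊔ Subgroup.zpowers x := le_sup_left
  have hxH : x ∈ (P : Subgroup G) ⊔ Subgroup.zpowers x :=
    Subgroup.mem_sup_right (Subgroup.mem_zpowers x)
  obtain ⟨k, hk⟩ := hq
  refine ⟨P.subtype hPH, ⟨x, hxH⟩, ?_, ⟨k, Subtype.ext (by simpa using hk)⟩, ⟨u, hPH hu⟩, hu,
    fun h => hxu (congrArg Subtype.val h)⟩
  rw [Sylow.coe_subtype, Subgroup.mem_normalizer_iff]
  rintro ⟨g, hg⟩
  exact Subgroup.mem_normalizer_iff.1 hx g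

/-- Without an action, P centralizes every Sylow q-subgroup S. The normalizer of S thus contains P
and S, its index has no prime divisor, and all Sylow subgroups are normal. -/
theorem isNilpotent_of_not_hasSylowAction {G : Type} [Group G] [Finite G] {p q : ℕ} (hp : p.Prime)
    (hq : q.Prime) (P : Sylow p G) (hP : (P : Subgroup G).Normal)
    (hG : ∀ r, r.Prime → r ∣ Nat.card G → r = p ∨ r = q) (hact : ¬ HasSylowAction G p q) :
    Group.IsNilpotent G := by
  have := Fact.mk hp
  have := Fact.mk hq
  refine (Group.isNilpotent_of_finite_tfae (G := G)).out 3 0 |>.1 ?_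
  intro r hr S
  by_cases hrG : r ∣ Nat.card G
  · rcases hG r hr.out hrG with rfl | rfl
    · have := P.unique_of_normal hP
      rwa [Subsingleton.elim S P]
    · rw [← Subgroup.normalizer_eq_top_iff, ← Subgroup.index_eq_one]
      have hPS : (P : Subgroup G) ≤ Subgroup.normalizer ((S : Subgroup G) : Set G) := by
        refine le_trans ?_ (Subgroup.centralizer_le_normalizer _)
        intro u hu
        rw [Subgroup.mem_centralizer_iff]
        intro x hx
        by_contra hxu
        refine hact ⟨P, x, ?_, S.2.exists_pow_mem hx, u, hu, hxu⟩
        rw [Subgroup.normalizer_eq_top_iff.2 hP]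
        trivial
      rw [Nat.eq_one_iff_not_exists_prime_dvd]
      intro s hs hd
      rcases hG s hs (hd.trans (Subgroup.index_dvd_card _)) with rfl | rfl
      · exact P.not_dvd_index (hd.trans (Subgroup.index_dvd_of_le hPS))
      · exact S.not_dvd_index (hd.trans (Subgroup.index_dvd_of_le Subgroup.le_normalizer))
  · have hb : (S : Subgroup G) = ⊥ := by
      rw [← Subgroup.card_eq_one]
      obtain ⟨n, hn⟩ := IsPGroup.iff_card.1 S.2
      have hn' : Nat.card (S : Subgroup G) = r ^ n := hn
      rcases Nat.eq_zero_or_pos n with rfl | h0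
      · simpa using hn'
      · exact absurd (((dvd_pow_self r h0.ne').trans hn'.symm.dvd).trans
          (Subgroup.card_subgroup_dvd_card _)) hrG
    rw [hb]
    infer_instance

theorem HasSylowAction.not_isNilpotent {G : Type} [Group G] [Finite G] {p q : ℕ} (hp : p.Prime)
    (hq : q.Prime) (hpq : p ≠ q) (h : HasSylowAction G p q) : ¬ Group.IsNilpotent G := by
  intro hG
  have := Fact.mk hq
  obtain ⟨S⟩ : Nonempty (Sylow q G) := inferInstance
  exact not_hasSylowAction_of_normal hq hp hpq.symm S inferInstance h

theorem FiniteGroupClass.hasShemetkovProperty_of_isRecognizedBy_sylowGraph {F : FiniteGroupClass}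
    (hne : F.IsNonempty) (hform : F.IsFormation) (hher : F.IsHereditary)
    (hrec : F.IsRecognizedBy sylowGraph) : F.HasShemetkovProperty := by
  rintro G _ _ ⟨hG, hsub⟩
  by_cases hv : (sylowGraph G).verts ⊆ (F.graph sylowGraph).verts
  · have he : ¬ (sylowGraph G).edges ⊆ (F.graph sylowGraph).edges := fun he =>
      hG (mem_of_sylowGraph_subset hne hform hher hrec G hv he)
    obtain ⟨⟨p, q⟩, hpqG, hpqF⟩ := Set.not_subset.1 he
    obtain ⟨hp, hq, hpq, hact⟩ := (mem_edges_sylowGraph_iff G p q).1 hpqG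
    have hproper : ∀ H : Subgroup G, H ≠ ⊤ → ¬ HasSylowAction H p q := fun H hH h =>
      hpqF (edges_subset_graph (hsub H hH) ((mem_edges_sylowGraph_iff H p q).2 ⟨hp, hq, hpq, h⟩))
    refine Or.inl ⟨hact.not_isNilpotent hp hq hpq, ?_⟩
    obtain ⟨P, x, hx, ⟨k, hk⟩, u, hu, hxu⟩ := hact
    -- A proper subgroup P⟨x⟩ would lie in F and contribute the missing edge.
    have htop : (P : Subgroup G) ⊔ Subgroup.zpowers x = ⊤ := by
      by_contra h
      exact hproper _ h (hasSylowAction_sup_zpowers P hx ⟨k, hk⟩ hu hxu)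
    have hP : (P : Subgroup G).Normal := by
      rw [← Subgroup.normalizer_eq_top_iff, eq_top_iff, ← htop]
      exact sup_le Subgroup.le_normalizer (by rwa [Subgroup.zpowers_le])
    intro H hH
    have := Fact.mk hp
    have hidx : ¬ p ∣ ((P : Subgroup G).subgroupOf H).index := fun h =>
      P.not_dvd_index (h.trans (Subgroup.relIndex_dvd_index_of_normal (P : Subgroup G) H))
    have hpg : IsPGroup p ((P : Subgroup G).subgroupOf H) := P.2.comap_subtype
    refine isNilpotent_of_not_hasSylowAction hp hq (hpg.toSylow hidx) ?_ ?_
      (hproper H hH)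
    · rw [IsPGroup.toSylow_coe]
      exact Subgroup.normal_subgroupOf
    · exact fun r hr hrH => prime_eq_or_eq_of_sup_zpowers_eq_top hp hq P hP hk htop hr
        (hrH.trans (Subgroup.card_subgroup_dvd_card H))
  · obtain ⟨r, ⟨hr, hrG⟩, hrF⟩ := Set.not_subset.1 hv
    have := Fact.mk hr
    obtain ⟨g, hg⟩ := exists_prime_orderOf_dvd_card' r hrG
    have hcard : Nat.card (Subgroup.zpowers g) = r := by rw [Nat.card_zpowers, hg]
    have htop : Subgroup.zpowers g = ⊤ := by
      by_contra h
      exact hrF (verts_subset_graph (hsub _ h) ⟨hr, hcard.symm.dvd⟩)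
    right
    rw [htop, Subgroup.card_top] at hcard
    rwa [hcard]

/-! ### Nongenerating normal p-subgroups of soluble groups -/

/-- A minimal nontrivial normal subgroup inside C is abelian by solubility; its elements of order
dividing r form a normal subgroup. -/
theorem Subgroup.exists_normal_isPGroup_le {G : Type*} [Group G] [Finite G] [Group.IsSolvable G]
    {C : Subgroup G} (hC : C.Normal) (hC1 : C ≠ ⊥) :
    ∃ r : ℕ, r.Prime ∧ ∃ U : Subgroup G, U.Normal ∧ U ≤ C ∧ U ≠ ⊥ ∧ IsPGroup r U := by
  obtain ⟨U, ⟨hUn, hUC, hU1⟩, hmin⟩ := WellFounded.has_min (wellFounded_lt (α := Subgroup G))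
    {U : Subgroup G | U.Normal ∧ U ≤ C ∧ U ≠ ⊥} ⟨C, hC, le_rfl, hC1⟩
  have hlt := Group.IsSolvable.commutator_lt_of_ne_bot hU1
  have hcomm : ⁅U, U⁆ = ⊥ := by
    by_contra h
    exact hmin _ ⟨inferInstance, hlt.le.trans hUC, h⟩ hlt
  have hab : ∀ a ∈ U, ∀ b ∈ U, Commute a b := by
    intro a ha b hb
    have h := Subgroup.commutator_mem_commutator ha hb
    rw [hcomm, Subgroup.mem_bot] at h
    exact commutatorElement_eq_one_iff_commute.1 h
  have hcard : Nat.card U ≠ 1 := fun h => hU1 (Subgroup.card_eq_one.1 h)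
  obtain ⟨r, hr, hrU⟩ := Nat.exists_prime_and_dvd hcard
  have := Fact.mk hr
  obtain ⟨u, hu⟩ := exists_prime_orderOf_dvd_card' r hrU
  let V : Subgroup G :=
    { carrier := {g | g ∈ U ∧ g ^ r = 1}
      one_mem' := ⟨U.one_mem, one_pow r⟩
      mul_mem' := fun {a b} ha hb => ⟨U.mul_mem ha.1 hb.1, by
        rw [(hab a ha.1 b hb.1).mul_pow, ha.2, hb.2, one_mul]⟩
      inv_mem' := fun {a} ha => ⟨U.inv_mem ha.1, by rw [inv_pow, ha.2, inv_one]⟩ }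
  refine ⟨r, hr, V, ⟨fun n hn g => ⟨hUn.conj_mem n hn.1 g, ?_⟩⟩, fun g hg => hUC hg.1, ?_, ?_⟩
  · rw [conj_pow, hn.2, mul_one, mul_inv_cancel]
  · have hur : u ^ r = 1 := orderOf_dvd_iff_pow_eq_one.1 hu.dvd
    have huV : (u : G) ∈ V := ⟨u.2, by simpa using congrArg Subtype.val hur⟩
    intro h
    rw [h, Subgroup.mem_bot] at huV
    have hu1 : u = 1 := Subtype.ext huV
    rw [hu1, orderOf_one] at hu
    exact hr.one_lt.ne hu
  · rw [isPGroup_iff_pow_pow_eq_one]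
    rintro ⟨g, hg⟩
    exact ⟨1, Subtype.ext (by simpa using hg.2)⟩

theorem IsPGroup.dvd_card_of_ne_bot {G : Type*} [Group G] [Finite G] {p : ℕ} [Fact p.Prime]
    {U : Subgroup G} (hU : IsPGroup p U) (h : U ≠ ⊥) : p ∣ Nat.card U :=
  hU.card_eq_or_dvd.resolve_left fun hc => h (Subgroup.card_eq_one.1 hc)

theorem Subgroup.card_comap_mk' {G : Type*} [Group G] [Finite G] (N : Subgroup G) [N.Normal]
    (U : Subgroup (G ⧸ N)) :
    Nat.card (U.comap (QuotientGroup.mk' N)) = Nat.card N * Nat.card U := by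
  have h : N ≤ U.comap (QuotientGroup.mk' N) := by
    simpa using (QuotientGroup.mk' N).ker_le_comap U
  have h2 := Subgroup.relIndex_ker (U.comap (QuotientGroup.mk' N)) (QuotientGroup.mk' N)
  rw [QuotientGroup.ker_mk',
    Subgroup.map_comap_eq_self_of_surjective (QuotientGroup.mk'_surjective N)] at h2
  rw [← h2, Subgroup.relIndex, ← Subgroup.card_mul_index (N.subgroupOf _),
    Nat.card_congr (Subgroup.subgroupOfEquivOfLe h).toEquiv]

/-- In a finite soluble group without nontrivial normal `p'`-subgroups, an element centralizing
every normal `p`-subgroup lies in a normal `p`-subgroup. -/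
theorem exists_mem_normal_isPGroup_of_forall_commute {G : Type} [Group G] [Finite G]
    [Group.IsSolvable G] {p : ℕ} (hp : p.Prime)
    (hO : ∀ r : ℕ, r.Prime → r ≠ p → ∀ U : Subgroup G, U.Normal → IsPGroup r U → U = ⊥) {x : G}
    (hx : ∀ A : Subgroup G, A.Normal → IsPGroup p A → ∀ a ∈ A, Commute x a) :
    ∃ A : Subgroup G, A.Normal ∧ IsPGroup p A ∧ x ∈ A := by
  have := Fact.mk hp
  let A : Subgroup G := sSup {N : Subgroup G | N.Normal ∧ IsPGroup p N}
  have hAn : A.Normal := Subgroup.sSup_normal _ fun _ h => h.1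
  have hAp : IsPGroup p A := Sylow.sSup_of_normal _ (fun _ h => h.2) fun _ h => h.1
  have hAmax : ∀ N : Subgroup G, N.Normal → IsPGroup p N → N ≤ A := fun N h1 h2 => le_sSup ⟨h1, h2⟩
  let C : Subgroup G := Subgroup.centralizer (A : Set G)
  have hCn : C.Normal := Subgroup.normal_centralizer
  have hxC : x ∈ C := Subgroup.mem_centralizer_iff.2 fun a ha => (hx A hAn hAp a ha).symm.eq
  refine ⟨A, hAn, hAp, ?_⟩
  let Z : Subgroup G := C ⊓ A
  have hZn : Z.Normal := inferInstanceAs (C ⊓ A).Normal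
  have hZp : IsPGroup p Z := hAp.to_le inf_le_right
  let π := QuotientGroup.mk' Z
  have hπ : Function.Surjective π := QuotientGroup.mk'_surjective Z
  have hker : π.ker = Z := QuotientGroup.ker_mk' Z
  -- Hall–Higman: if C is not inside Z = C ∩ A, then C/Z contains a nontrivial normal r-subgroup of
  -- G/Z, with preimage U. For r = p, U is a normal p-subgroup, so U ≤ A. For r ≠ p, Z is a central
  -- Sylow p-subgroup of U, so U is nilpotent and its Sylow r-subgroup is normal in G, against `hO`.
  by_cases hD : C.map π = ⊥
  · have h : C ≤ Z := by
      rw [Subgroup.map_eq_bot_iff, hker] at hD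
      exact hD
    exact (h hxC).2
  exfalso
  obtain ⟨r, hr, V, hVn, hVC, hV1, hVp⟩ :=
    Subgroup.exists_normal_isPGroup_le (hCn.map π hπ) hD
  have := Fact.mk hr
  set U := V.comap π with hU
  have hUn : U.Normal := hVn.comap π
  have hZU : Z ≤ U := hker ▸ π.ker_le_comap V
  have hUC : U ≤ C := by
    refine (Subgroup.comap_mono hVC).trans ?_
    rw [Subgroup.comap_map_eq, hker]
    exact sup_le le_rfl inf_le_left
  have hVmap : V = U.map π := (Subgroup.map_comap_eq_self_of_surjective hπ V).symm
  by_cases hrp : r = p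
  · subst hrp
    have hUp : IsPGroup r U := hVp.comap_of_ker_isPGroup π (by rwa [hker])
    refine hV1 ?_
    rw [hVmap, Subgroup.map_eq_bot_iff, hker]
    exact le_inf hUC (hAmax U hUn hUp)
  · obtain ⟨n, hn⟩ := IsPGroup.iff_card.1 hVp
    obtain ⟨m, hm⟩ := IsPGroup.iff_card.1 hZp
    have hcard : Nat.card U = Nat.card Z * Nat.card V := Subgroup.card_comap_mk' Z V
    have hZUp : IsPGroup p (Z.subgroupOf U) :=
      hZp.comap_of_injective U.subtype (Subgroup.subtype_injective U)
    have hidx : ¬ p ∣ (Z.subgroupOf U).index := by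
      change ¬ p ∣ Z.relIndex U
      have h2 := Subgroup.relIndex_ker U π
      rw [hker, ← hVmap, hn] at h2
      rw [h2]
      exact fun h => hrp ((Nat.prime_dvd_prime_iff_eq hp hr).1 (hp.dvd_of_dvd_pow h)).symm
    have hnil : Group.IsNilpotent U := by
      refine isNilpotent_of_not_hasSylowAction hp hr (hZUp.toSylow hidx) ?_ ?_ ?_
      · rw [IsPGroup.toSylow_coe]
        exact Subgroup.normal_subgroupOf
      · intro s hs hsU
        rw [hcard, hn, hm] at hsU
        rcases hs.dvd_mul.1 hsU with h | h
        · exact Or.inl ((Nat.prime_dvd_prime_iff_eq hs hp).1 (hs.dvd_of_dvd_pow h))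
        · exact Or.inr ((Nat.prime_dvd_prime_iff_eq hs hr).1 (hs.dvd_of_dvd_pow h))
      · rintro ⟨S, y, -, -, u, hu, hyu⟩
        have hnorm : (Z.subgroupOf U).Normal := Subgroup.normal_subgroupOf
        have := (hZUp.toSylow hidx).unique_of_normal (by rwa [IsPGroup.toSylow_coe])
        rw [Subsingleton.elim S (hZUp.toSylow hidx), IsPGroup.mem_toSylow,
          Subgroup.mem_subgroupOf] at hu
        exact hyu (Subtype.ext (Subgroup.mem_centralizer_iff.1 (hUC y.2) u hu.2).symm)
    obtain ⟨S⟩ : Nonempty (Sylow r U) := inferInstance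
    have hSc : (S : Subgroup U).Characteristic := S.characteristic_of_normal inferInstance
    have hSn : ((S : Subgroup U).map U.subtype).Normal := inferInstance
    have hS0 := hO r hr hrp _ hSn (S.2.map U.subtype)
    rw [Subgroup.map_eq_bot_iff_of_injective _ (Subgroup.subtype_injective U)] at hS0
    refine S.ne_bot_of_dvd_card ?_ hS0
    rw [hcard]
    exact (hVp.dvd_card_of_ne_bot hV1).mul_left _

/-- If `G` has no nontrivial normal `r`-subgroup and `M` is a normal subgroup consisting of
nongenerators, then `G / M` has no nontrivial normal `r`-subgroup. -/
theorem eq_bot_of_normal_isPGroup_quotient {G : Type*} [Group G] [Finite G]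
    (M : Subgroup G) [M.Normal]
    (hgen : ∀ K : Subgroup G, K ⊔ M = ⊤ → K = ⊤) {r : ℕ} (hr : r.Prime)
    (hO : ∀ U : Subgroup G, U.Normal → IsPGroup r U → U = ⊥) (V : Subgroup (G ⧸ M))
    (hVn : V.Normal) (hV : IsPGroup r V) : V = ⊥ := by
  have := Fact.mk hr
  by_contra hV1
  let π := QuotientGroup.mk' M
  have hker : π.ker = M := QuotientGroup.ker_mk' M
  have hπ : Function.Surjective π := QuotientGroup.mk'_surjective M
  set U := V.comap π with hU
  have hUn : U.Normal := hVn.comap π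
  have hMU : M ≤ U := hker ▸ π.ker_le_comap V
  obtain ⟨S⟩ : Nonempty (Sylow r U) := inferInstance
  set S₀ := (S : Subgroup U).map U.subtype with hS₀
  have hS₀U : S₀ ≤ U := Subgroup.map_subtype_le _
  obtain ⟨n, hn⟩ := IsPGroup.iff_card.1 hV
  -- The index divides both |U : M|, a power of r, and |U : S₀|, which is prime to r.
  have hUMS : U ≤ S₀ ⊔ M := by
    rw [← Subgroup.relIndex_eq_one, Nat.eq_one_iff_not_exists_prime_dvd]
    intro s hs hd
    have h1 : s ∣ M.relIndex U := hd.trans (Subgroup.relIndex_dvd_of_le_left U le_sup_right)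
    have h2 := Subgroup.relIndex_ker U π
    rw [hker, Subgroup.map_comap_eq_self_of_surjective hπ, hn] at h2
    rw [h2] at h1
    obtain rfl : s = r := (Nat.prime_dvd_prime_iff_eq hs hr).1 (hs.dvd_of_dvd_pow h1)
    have h3 : s ∣ S₀.relIndex U := hd.trans (Subgroup.relIndex_dvd_of_le_left U le_sup_left)
    have h4 : S₀.subgroupOf U = S :=
      Subgroup.comap_map_eq_self_of_injective (Subgroup.subtype_injective U) _
    rw [Subgroup.relIndex, h4] at h3
    exact S.not_dvd_index h3
  -- Frattini argument: G is the product of the normalizer of S₀ with U, hence with M, which is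
  -- nongenerating.
  have htop : Subgroup.normalizer (S₀ : Set G) = ⊤ := by
    refine hgen _ ?_
    rw [eq_top_iff, ← Sylow.normalizer_sup_eq_top S]
    refine sup_le le_sup_left (hUMS.trans (sup_le_sup_right ?_ M))
    exact Subgroup.le_normalizer
  have hS1 := hO S₀ (Subgroup.normalizer_eq_top_iff.1 htop) (S.2.map U.subtype)
  rw [hS₀, Subgroup.map_eq_bot_iff_of_injective _ (Subgroup.subtype_injective U)] at hS1
  refine S.ne_bot_of_dvd_card ?_ hS1
  rw [show Nat.card U = _ from Subgroup.card_comap_mk' M V]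
  exact (hV.dvd_card_of_ne_bot hV1).mul_left _

/-- In a finite soluble group, a `p'`-element of prime power order that centralizes a Sylow
`p`-subgroup modulo a nongenerating normal `p`-subgroup `M` centralizes `M`. -/
theorem commute_of_nongenerating {p q : ℕ} (hp : p.Prime) (hq : q.Prime) (hpq : p ≠ q) (n : ℕ) :
    ∀ (G : Type) [Group G] [Finite G] [Group.IsSolvable G] (M : Subgroup G) [M.Normal],
      Nat.card G = n → IsPGroup p M → (∀ K : Subgroup G, K ⊔ M = ⊤ → K = ⊤) →
      ∀ (P : Sylow p G) (x : G) (k : ℕ), x ^ q ^ k = 1 → (∀ u ∈ P, u⁻¹ * (x * u * x⁻¹) ∈ M) →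
      ∀ m ∈ M, Commute x m := by
  have := Fact.mk hp
  induction n using Nat.strong_induction_on with
  | _ n ih =>
    intro G _ _ _ M _ hcard hM hgen P x k hk hxP m hm
    -- If G has no nontrivial normal p'-subgroup of prime power order, neither has G/M, and
    -- Hall–Higman there puts the image of x in a p-group, whence x = 1. Otherwise induction applies
    -- to G/U, and [x, m] lies in U ∩ M = 1.
    by_cases hO : ∀ r : ℕ, r.Prime → r ≠ p → ∀ U : Subgroup G, U.Normal → IsPGroup r U → U = ⊥
    · let π := QuotientGroup.mk' M
      have hker : π.ker = M := QuotientGroup.ker_mk' M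
      have hπ : Function.Surjective π := QuotientGroup.mk'_surjective M
      obtain ⟨A, hAn, hAp, hxA⟩ := exists_mem_normal_isPGroup_of_forall_commute (G := G ⧸ M)
        (x := π x) hp
        (fun r hr hrp V hVn hV => eq_bot_of_normal_isPGroup_quotient M hgen hr
          (hO r hr hrp) V hVn hV) (by
          intro A hAn hAp a ha
          obtain ⟨u, rfl⟩ := hπ a
          have hnorm : (A.comap π).Normal := hAn.comap π
          have hu : u ∈ P := IsPGroup.le_sylow_of_normal
            (hAp.comap_of_ker_isPGroup π (by rwa [hker])) P ha
          have h := hxP u hu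
          rw [← hker, MonoidHom.mem_ker, map_mul, map_mul, map_mul, map_inv, map_inv,
            inv_mul_eq_one] at h
          exact (mul_inv_eq_iff_eq_mul.1 h.symm))
      obtain ⟨i, hi⟩ := hAp.exists_pow_mem hxA
      have h1 : π x = 1 := eq_one_of_pow_prime_pow hp hq hpq hi
        (by rw [← map_pow, hk, map_one] : π x ^ q ^ k = 1)
      have hxM : x ∈ M := by rwa [← hker, MonoidHom.mem_ker]
      obtain ⟨j, hj⟩ := hM.exists_pow_mem hxM
      rw [eq_one_of_pow_prime_pow hp hq hpq hj hk]
      exact Commute.one_left m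
    · push Not at hO
      obtain ⟨r, hr, hrp, U, hUn, hUr, hU1⟩ := hO
      let π := QuotientGroup.mk' U
      have hker : π.ker = U := QuotientGroup.ker_mk' U
      have hπ : Function.Surjective π := QuotientGroup.mk'_surjective U
      have hlt : Nat.card (G ⧸ U) < n := by
        rw [← hcard, Subgroup.card_eq_card_quotient_mul_card_subgroup U]
        refine lt_mul_of_one_lt_right Nat.card_pos ?_
        exact (Subgroup.one_lt_card_iff_ne_bot U).2 hU1
      have hMn : (M.map π).Normal := Subgroup.Normal.map inferInstance π hπ
      have hcomm := ih _ hlt (G ⧸ U) (M.map π) rfl (hM.map π) (by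
          intro K hK
          have h1 : K.comap π ⊔ M = ⊤ := by
            have h2 : (K.comap π ⊔ M).map π = ⊤ := by
              rw [Subgroup.map_sup, Subgroup.map_comap_eq_self_of_surjective hπ, hK]
            have h3 : (K.comap π ⊔ M) ⊔ π.ker = ⊤ := by
              rw [← Subgroup.comap_map_eq, h2, Subgroup.comap_top]
            rwa [sup_eq_left.2 ((π.ker_le_comap K).trans le_sup_left)] at h3
          have h4 := hgen _ h1
          rw [← Subgroup.map_comap_eq_self_of_surjective hπ K, h4,
            Subgroup.map_top_of_surjective π hπ])
        (P.mapSurjective hπ) (π x) k (by rw [← map_pow, hk, map_one]) (by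
          rintro _ ⟨u, hu, rfl⟩
          exact ⟨_, hxP u hu, by simp⟩) (π m) ⟨m, hm, rfl⟩
      have h1 : x * m * x⁻¹ * m⁻¹ ∈ U := by
        rw [← hker, MonoidHom.mem_ker, map_mul, map_mul, map_mul, map_inv, map_inv, hcomm.eq]
        group
      have h2 : x * m * x⁻¹ * m⁻¹ ∈ M :=
        mul_mem (Subgroup.Normal.conj_mem inferInstance m hm x) (inv_mem hm)
      obtain ⟨i, hi⟩ := hM.exists_pow_mem h2
      obtain ⟨j, hj⟩ := hUr.exists_pow_mem h1
      have h3 := eq_one_of_pow_prime_pow hp hr hrp.symm hi hj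
      exact mul_inv_eq_iff_eq_mul.1 (mul_inv_eq_one.1 h3)

/-! ### Soluble saturation -/

theorem Subgroup.isSolvable_sup_of_normal {G : Type*} [Group G] (K N : Subgroup G) [N.Normal]
    (hK : Group.IsSolvable K) (hN : Group.IsSolvable N) :
    Group.IsSolvable (K ⊔ N : Subgroup G) := by
  have h1 : Group.IsSolvable ((K ⊔ N : Subgroup G) ⧸ N.subgroupOf (K ⊔ N)) :=
    Group.isSolvable_of_surjective
      (f := (QuotientGroup.quotientInfEquivProdNormalQuotient K N).toMonoidHom)
      (QuotientGroup.quotientInfEquivProdNormalQuotient K N).surjective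
  have h2 : Group.IsSolvable (N.subgroupOf (K ⊔ N)) :=
    Group.isSolvable_of_isSolvable_injective
      (f := (Subgroup.subgroupOfEquivOfLe (le_sup_right : N ≤ K ⊔ N)).toMonoidHom)
      (Subgroup.subgroupOfEquivOfLe (le_sup_right : N ≤ K ⊔ N)).injective
  exact (Group.isSolvable_iff_subgroup_quotient (N.subgroupOf (K ⊔ N))).2 ⟨h2, h1⟩

theorem isSolvable_solubleRadical (G : Type) [Group G] [Finite G] :
    Group.IsSolvable (solubleRadical G) := by
  obtain ⟨R, ⟨hRn, hR⟩, hmax⟩ := WellFounded.has_min (wellFounded_gt (α := Subgroup G))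
    {N : Subgroup G | N.Normal ∧ Group.IsSolvable N} ⟨⊥, inferInstance, inferInstance⟩
  have h : solubleRadical G = R := by
    refine le_antisymm (sSup_le ?_) (le_sSup ⟨hRn, hR⟩)
    rintro N ⟨hNn, hN⟩
    by_contra hle
    exact hmax (N ⊔ R) ⟨inferInstance, Subgroup.isSolvable_sup_of_normal N R hN hR⟩
      (right_lt_sup.2 hle)
  rw [h]
  exact hR

/-- The primes dividing the order of a finite group divide the index of its Frattini subgroup. -/
theorem dvd_index_frattini_of_dvd_card {G : Type*} [Group G] [Finite G] {p : ℕ} (hp : p.Prime)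
    (hpG : p ∣ Nat.card G) : p ∣ (frattini G).index := by
  by_contra hidx
  have := Fact.mk hp
  have hnil : Group.IsNilpotent (frattini G) := frattini_nilpotent
  obtain ⟨S⟩ : Nonempty (Sylow p (frattini G)) := inferInstance
  have hSc : (S : Subgroup (frattini G)).Characteristic := S.characteristic_of_normal inferInstance
  -- P is a normal Sylow p-subgroup of G. Its Schur–Zassenhaus complement H satisfies HΦ(G) = G, so
  -- H = G and P = 1.
  set P : Subgroup G := (S : Subgroup (frattini G)).map (frattini G).subtype with hP
  have hPn : P.Normal := inferInstance
  have hPle : P ≤ frattini G := Subgroup.map_subtype_le _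
  have hPidx : ¬ p ∣ P.index := by
    rw [← Subgroup.relIndex_mul_index hPle, hp.dvd_mul]
    refine not_or_intro ?_ hidx
    have h4 : P.subgroupOf (frattini G) = S :=
      Subgroup.comap_map_eq_self_of_injective (Subgroup.subtype_injective _) _
    rw [Subgroup.relIndex, h4]
    exact S.not_dvd_index
  obtain ⟨n, hn⟩ := IsPGroup.iff_card.1 (S.2.map (frattini G).subtype)
  have hcop : (Nat.card P).Coprime P.index := by
    rw [hn]
    exact Nat.Coprime.pow_left n ((Nat.Prime.coprime_iff_not_dvd hp).2 hPidx)
  obtain ⟨H, hH⟩ := Subgroup.exists_right_complement'_of_coprime hcop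
  have hHtop : H = ⊤ := frattini_nongenerating (by
    rw [eq_top_iff, ← hH.sup_eq_top, sup_comm]
    exact sup_le_sup_left hPle H)
  have hPbot : P = ⊥ := by
    have := hH.disjoint
    rwa [hHtop, disjoint_top] at this
  rw [hPbot, Subgroup.index_bot] at hPidx
  exact hPidx hpG

theorem frattiniSolubleRadical_le (G : Type) [Group G] :
    frattiniSolubleRadical G ≤ solubleRadical G := Subgroup.map_subtype_le _

/-- Since PR is a subgroup, |R : P ∩ R| = |PR : P|. For P Sylow this makes P ∩ R Sylow in R. -/
theorem Subgroup.relIndex_dvd_index_of_right_normal {G : Type*} [Group G] [Finite G]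
    (P R : Subgroup G) [R.Normal] : P.relIndex R ∣ P.index := by
  have h1 : Nat.card (P ⊓ R : Subgroup G) * P.relIndex R = Nat.card R := by
    rw [← Subgroup.inf_relIndex_right, ← Subgroup.relIndex_bot_left,
      Subgroup.relIndex_mul_relIndex _ _ _ bot_le inf_le_right, Subgroup.relIndex_bot_left]
  have h2 : Nat.card (P ⊓ R : Subgroup G) * R.relIndex P = Nat.card P := by
    rw [← Subgroup.inf_relIndex_left, ← Subgroup.relIndex_bot_left,
      Subgroup.relIndex_mul_relIndex _ _ _ bot_le inf_le_left, Subgroup.relIndex_bot_left]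
  have h3 : Nat.card R * R.relIndex P = Nat.card (P ⊔ R : Subgroup G) := by
    rw [← Subgroup.relIndex_sup_right P R, ← Subgroup.relIndex_bot_left,
      Subgroup.relIndex_mul_relIndex _ _ _ bot_le le_sup_right, Subgroup.relIndex_bot_left]
  have h4 : Nat.card P * P.relIndex (P ⊔ R) = Nat.card (P ⊔ R : Subgroup G) := by
    rw [← Subgroup.relIndex_bot_left,
      Subgroup.relIndex_mul_relIndex _ _ _ bot_le le_sup_left, Subgroup.relIndex_bot_left]
  have h5 : P.relIndex R = P.relIndex (P ⊔ R) := by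
    have hpos : 0 < Nat.card P := Nat.card_pos
    refine Nat.eq_of_mul_eq_mul_left hpos ?_
    rw [h4, ← h3, ← h1, ← h2]
    ring
  rw [h5]
  exact Subgroup.relIndex_dvd_index_of_le le_sup_left

theorem exists_normal_sylow_of_isNilpotent {G : Type*} [Group G] [Finite G] (p : ℕ) [Fact p.Prime]
    (N : Subgroup G) [N.Normal] (hN : Group.IsNilpotent N) :
    ∃ M : Subgroup G, M.Normal ∧ IsPGroup p M ∧ M ≤ N ∧
      ∀ g ∈ N, ∀ k, g ^ p ^ k = 1 → g ∈ M := by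
  obtain ⟨S⟩ : Nonempty (Sylow p N) := inferInstance
  have hSc : (S : Subgroup N).Characteristic := S.characteristic_of_normal inferInstance
  refine ⟨(S : Subgroup N).map N.subtype, inferInstance, S.2.map N.subtype,
    Subgroup.map_subtype_le _, fun g hg k hk => ⟨⟨g, hg⟩, ?_, rfl⟩⟩
  exact S.mem_of_normal (k := k) (Subtype.ext (by simpa using hk))

/-- G need not be soluble, so `commute_of_nongenerating` is applied in T = ⟨x⟩R, to the Sylow
p-subgroup M of Φ(R). The commutators of x with P are p-elements of Φ(R), so they lie in M. -/
theorem commute_of_commutator_mem_frattiniSolubleRadical {G : Type} [Group G] [Finite G]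
    {p q : ℕ} (hp : p.Prime) (hq : q.Prime) (hpq : p ≠ q) (P : Sylow p G) {x : G} {k : ℕ}
    (hxN : x ∈ Subgroup.normalizer ((P : Subgroup G) : Set G)) (hk : x ^ q ^ k = 1)
    (hx : ∀ u ∈ P, u⁻¹ * (x * u * x⁻¹) ∈ frattiniSolubleRadical G) {u : G} (hu : u ∈ P) :
    Commute x u := by
  have := Fact.mk hp
  set R := solubleRadical G with hR
  have hsol : Group.IsSolvable R := isSolvable_solubleRadical G
  have hnilΦ : Group.IsNilpotent (frattini R) := frattini_nilpotent
  have hnil : Group.IsNilpotent (frattiniSolubleRadical G) :=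
    Group.nilpotent_of_mulEquiv
      ((frattini R).equivMapOfInjective R.subtype (Subgroup.subtype_injective R))
  obtain ⟨M, hMn, hMp, hMN, hM⟩ :=
    exists_normal_sylow_of_isNilpotent p (frattiniSolubleRadical G) hnil
  have hMR : M ≤ R := hMN.trans (frattiniSolubleRadical_le G)
  have hconjP : ∀ v ∈ P, v⁻¹ * (x * v * x⁻¹) ∈ (P : Subgroup G) := fun v hv =>
    mul_mem (inv_mem hv) ((Subgroup.mem_normalizer_iff.1 hxN v).1 hv)
  have hconjM : ∀ v ∈ P, v⁻¹ * (x * v * x⁻¹) ∈ M := by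
    intro v hv
    obtain ⟨i, hi⟩ := P.2.exists_pow_mem (hconjP v hv)
    exact hM _ (hx v hv) i hi
  set T : Subgroup G := Subgroup.zpowers x ⊔ R with hT
  have hRT : R ≤ T := le_sup_right
  have hMT : M ≤ T := hMR.trans hRT
  have hTsol : Group.IsSolvable T :=
    Subgroup.isSolvable_sup_of_normal _ _ inferInstance hsol
  have hxT : x ∈ T := Subgroup.mem_sup_left (Subgroup.mem_zpowers x)
  -- |T : P ∩ R| = |T : R| |R : P ∩ R|, where |T : R| divides the order of x.
  have hPTidx : ¬ p ∣ ((P : Subgroup G).subgroupOf T).index := by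
    intro hd
    change p ∣ (P : Subgroup G).relIndex T at hd
    have h1 : p ∣ ((P : Subgroup G) ⊓ R).relIndex T :=
      hd.trans (Subgroup.relIndex_dvd_of_le_left T inf_le_left)
    rw [← Subgroup.relIndex_mul_relIndex _ _ _ inf_le_right hRT, Subgroup.inf_relIndex_right,
      hT, Subgroup.relIndex_sup_right, hp.dvd_mul] at h1
    rcases h1 with h1 | h1
    · exact P.not_dvd_index (h1.trans (Subgroup.relIndex_dvd_index_of_right_normal _ _))
    · have h2 := h1.trans (Subgroup.relIndex_dvd_card _ _)
      rw [Nat.card_zpowers] at h2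
      exact hpq ((Nat.prime_dvd_prime_iff_eq hp hq).1
        (hp.dvd_of_dvd_pow (h2.trans (orderOf_dvd_of_pow_eq_one hk))))
  have hPT : IsPGroup p ((P : Subgroup G).subgroupOf T) := P.2.comap_subtype
  have hMTn : (M.subgroupOf T).Normal := Subgroup.normal_subgroupOf
  have hgen : ∀ K : Subgroup T, K ⊔ M.subgroupOf T = ⊤ → K = ⊤ := by
    intro K hK
    have hdec : ∀ t : T, ∃ a ∈ K, ∃ m ∈ M.subgroupOf T, a * m = t := fun t =>
      Subgroup.mem_sup_of_normal_right.1 (hK ▸ Subgroup.mem_top t)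
    let K₀ : Subgroup G := K.map T.subtype
    -- Dedekind: from KM = T and M ≤ R it follows that R = (K ∩ R)M. As M ≤ Φ(R), this gives R ≤ K,
    -- hence M ≤ K.
    have hL : K₀.subgroupOf R = ⊤ := by
      refine frattini_nongenerating ?_
      rw [eq_top_iff]
      rintro ⟨r, hr⟩ -
      obtain ⟨a, ha, m, hm, ham⟩ := hdec ⟨r, hRT hr⟩
      have ham' : (a : G) * m = r := congrArg Subtype.val ham
      have hm' : (m : G) ∈ M := hm
      have haR : (a : G) ∈ R := by
        rw [eq_mul_inv_of_mul_eq ham']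
        exact mul_mem hr (inv_mem (hMR hm'))
      obtain ⟨m₁, hm₁, hmm⟩ := hMN hm'
      have hsplit : (⟨r, hr⟩ : R) = ⟨a, haR⟩ * m₁ := Subtype.ext (by
        change r = (a : G) * m₁
        rw [← ham', ← hmm]
        rfl)
      rw [hsplit]
      exact mul_mem (Subgroup.mem_sup_left (Subgroup.mem_subgroupOf.2 ⟨a, ha, rfl⟩))
        (Subgroup.mem_sup_right hm₁)
    have hRK : R ≤ K₀ := Subgroup.subgroupOf_eq_top.1 hL
    rw [← hK, eq_comm, sup_eq_left]
    intro m hm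
    obtain ⟨a, ha, hma⟩ := hRK (hMR hm)
    rwa [← Subtype.ext (show (a : G) = m from hma)]
  have hxM := commute_of_nongenerating hp hq hpq _ T (M.subgroupOf T) rfl
    (hMp.comap_of_injective T.subtype (Subgroup.subtype_injective T)) hgen (hPT.toSylow hPTidx)
    ⟨x, hxT⟩ k (Subtype.ext (by simpa using hk)) (fun v hv => hconjM v hv)
  refine P.2.commute_of_commutator_mem hp hq hpq hk (hconjP u hu) ?_
  have h := hxM ⟨_, hMT (hconjM u hu)⟩ (hconjM u hu)
  exact congrArg Subtype.val h.eq

theorem FiniteGroupClass.isSolublySaturated_of_isRecognizedBy_sylowGraph {F : FiniteGroupClass}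
    (hne : F.IsNonempty) (hform : F.IsFormation) (hher : F.IsHereditary)
    (hrec : F.IsRecognizedBy sylowGraph) : F.IsSolublySaturated := by
  intro G _ _ hG
  refine mem_of_sylowGraph_subset hne hform hher hrec G ?_ ?_
  · rintro p ⟨hp, hpG⟩
    refine verts_subset_graph hG ⟨hp, ?_⟩
    change p ∣ (frattiniSolubleRadical G).index
    rw [← Subgroup.card_mul_index (frattiniSolubleRadical G), hp.dvd_mul] at hpG
    refine hpG.elim (fun h => ?_) id
    have h1 : p ∣ Nat.card (solubleRadical G) :=
      h.trans (Subgroup.card_dvd_of_le (frattiniSolubleRadical_le G))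
    have h2 := dvd_index_frattini_of_dvd_card hp h1
    have h3 : (frattiniSolubleRadical G).subgroupOf (solubleRadical G) =
        frattini (solubleRadical G) :=
      Subgroup.comap_map_eq_self_of_injective (Subgroup.subtype_injective _) _
    rw [← h3] at h2
    exact h2.trans (Subgroup.relIndex_dvd_index_of_normal _ _)
  · rintro ⟨p, q⟩ hpqG
    obtain ⟨hp, hq, hpq, P, x, hxN, ⟨k, hk⟩, u, hu, hxu⟩ := (mem_edges_sylowGraph_iff G p q).1 hpqG
    let π := QuotientGroup.mk' (frattiniSolubleRadical G)
    -- Either the action of x on P dies modulo Φ(R), and then it was trivial, or it survives and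
    -- gives the edge in the quotient.
    by_cases h : ∀ v ∈ P, π x * π v = π v * π x
    · refine absurd (commute_of_commutator_mem_frattiniSolubleRadical hp hq hpq P hxN hk ?_ hu).eq
        hxu
      intro v hv
      rw [← QuotientGroup.ker_mk' (frattiniSolubleRadical G), MonoidHom.mem_ker]
      change π _ = 1
      rw [map_mul, map_mul, map_mul, map_inv, map_inv, h v hv]
      group
    · push Not at h
      obtain ⟨v, hv, hxv⟩ := h
      exact edges_subset_graph hG ((mem_edges_sylowGraph_iff _ p q).2 ⟨hp, hq, hpq,
        HasSylowAction.of_surjective π (QuotientGroup.mk'_surjective _) hp P hxN ⟨k, hk⟩ hv hxv⟩)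

theorem theorem4p5 (F : FiniteGroupClass) (hne : F.IsNonempty)
    (hform : F.IsFormation) (hher : F.IsHereditary)
    (hrec : F.IsRecognizedBy sylowGraph) :
    (F.graph sylowGraph).IsUndirected ∧
      (F.IsFormation ∧ F.IsSolublySaturated ∧ F.HasShemetkovProperty) :=
  ⟨F.graph_sylowGraph_isUndirected hne hform hher hrec, hform,
    F.isSolublySaturated_of_isRecognizedBy_sylowGraph hne hform hher hrec,
    F.hasShemetkovProperty_of_isRecognizedBy_sylowGraph hne hform hher hrec⟩
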